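/- Let $k$ be a field, $G$ a group, $H\subseteq G$ a subgroup of finite index, and let $\gamma:H\times H\to k^{*}$ be a 2-cocycle (with trivial action, not necessarily normalised). Let $k[H,\gamma]$ be the skew group algebra, with basis $e_h$ $(h\in H)$ and product $e_fe_g=\gamma(f,g)e_{fg}$. Let $V$ be an irreducible projective representation of $H$ over $k$ with Schur multiplier $\gamma$, i.e. a non-zero vector space with an algebra homomorphism $\rho:k[H,\gamma]\to \mathrm{End}(V)$ such that the centraliser of the image of $\rho$ consists of the scalars. Then $\mathrm{End}(V)$ is an $H$-algebra via $h(x)=\rho(e_h)\,x\,\rho(e_h)^{-1}$. Let $$A(H,\gamma)=\mathrm{ind}_H^G\,\mathrm{End}(V)=\{a:G\to\mathrm{End}(V)\mid a(hg)=h(a(g))\ \ \forall h\in H,\ g\in G\}$$ be the induced $G$-algebra, with pointwise product and $G$-action $(f(a))(g)=a(gf)$; it is an algebra in the monoidal category $\mathcal{R}ep(G)$ of $k$-linear representations of $G$. Let $\mathcal Z(G)$ be the category of $G$-graded vector spaces $X=\bigoplus_{g}X_g$ with a $G$-action such that $f(X_g)=X_{fgf^{-1}}$. An object $X$ of $\mathcal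 Z(G)$ is regarded as an object of the monoidal centre of $\mathcal{R}ep(G)$ by the half-braiding $x\otimes u\mapsto g(u)\otimes x$ for $x\in X_g$, $u\in U$. Let $A(H,H,\gamma)$ be the algebra in $\mathcal Z(G)$ spanned by $a_{g,f}$ $(g\in G,\ f\in H)$ modulo the relations $$a_{gh,f}=\varepsilon_h(f)\,a_{g,hfh^{-1}}\quad(h\in H),\qquad \varepsilon_h(f)=\gamma(h,f)\,\gamma(hfh^{-1},h)^{-1},$$ with grading $|a_{g,f}|=gfg^{-1}$, $G$-action $g'(a_{g,f})=a_{g'g,f}$, and multiplication determined by $a_{g,f}a_{g,f'}=\gamma(f,f')a_{g,ff'}$ and $a_{g,f}a_{g',f'}=0$ if $gH\neq g'H$. For an algebra $A$ in a monoidal category $\mathcal C$, the full centre of $A$ is the terminal object among the pairs $(Z,\zeta)$, where $Z$ is an object of the monoidal centre of $\mathcal C$ with half-braiding $z$, and $\zeta:Z\to A$ is a morphism of $\mathcal C$ with $\mu(\zeta\otimes A)=\mu(A\otimes\zeta)z_A$; its algebra structure is the unique one for which $\zeta$ is a homomorphism of algebras in $\mathcal C$. Then the full centre of $A(H,\gamma)$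 is $A(H,H,\gamma)$, as an algebra in $\mathcal Z(G)$: there is a morphism $\zeta:A(H,H,\gamma)\to A(H,\gamma)$ of representations of $G$ which is a homomorphism of algebras and for which $(A(H,H,\gamma),\zeta)$ is terminal among the pairs described above for $A=A(H,\gamma)$, $\mathcal C=\mathcal{R}ep(G)$. -/

import Mathlib

open CategoryTheory MonoidalCategory TensorProduct

universe u v

noncomputable section

/-! ### The full centre of an algebra in a monoidal category -/

section FullCentre

variable {C : Type u} [Category.{v} C] [MonoidalCategory C]

/-- The condition on a pair `(Z, ζ)`, with `Z` in the monoidal centre of `C` and `ζ : Z ⟶ A` a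
morphism of `C`, that the two maps `Z ⊗ A ⟶ A`, namely `μ ∘ (ζ ⊗ A)` and
`μ ∘ (A ⊗ ζ) ∘ z_A` (where `z` is the half braiding of `Z`), coincide. -/
def IsCentralPair (A : C) [MonObj A] (Z : Center C) (ζ : Z.1 ⟶ A) : Prop :=
  (ζ ▷ A) ≫ MonObj.mul = (Z.2.β A).hom ≫ (A ◁ ζ) ≫ MonObj.mul

/-- `(Z, ζ)` is a full centre of the algebra `A`: it is terminal among the pairs satisfying
`IsCentralPair`. -/
structure IsFullCentre (A : C) [MonObj A] (Z : Center C) (ζ : Z.1 ⟶ A) : Prop where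
  central : IsCentralPair A Z ζ
  terminal : ∀ (Y : Center C) (ξ : Y.1 ⟶ A), IsCentralPair A Y ξ →
    ∃! φ : Y ⟶ Z, φ.f ≫ ζ = ξ

/-- The underlying morphism in `C` of an algebra `Z` in the centre of `C` to the algebra `A`
is a homomorphism of algebras in `C`. -/
structure IsAlgHomFromCenter (A : C) [MonObj A] (Z : Center C) [MonObj Z] (ζ : Z.1 ⟶ A) :
    Prop where
  one_hom : (MonObj.one : 𝟙_ (Center C) ⟶ Z).f ≫ ζ = (MonObj.one : 𝟙_ C ⟶ A)
  mul_hom : (MonObj.mul : Z ⊗ Z ⟶ Z).f ≫ ζ = (ζ ⊗ₘ ζ) ≫ (MonObj.mul : A ⊗ A ⟶ A)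

/-- The algebra `Z` in the centre of `C` is the full centre of the algebra `A` in `C`, with its
canonical algebra structure (the one for which the universal morphism `Z ⟶ A` is a homomorphism
of algebras in `C`). -/
def IsFullCentreAlgebra (A : C) [MonObj A] (Z : Center C) [MonObj Z] : Prop :=
  ∃ ζ : Z.1 ⟶ A, IsFullCentre A Z ζ ∧ IsAlgHomFromCenter A Z ζ

end FullCentre

/-! ### `G`-algebras -/

section GAlgebra

variable {k G : Type u} [Field k] [Group G] {B : Type u} [Ring B] [Algebra k B]

/-- The representation underlying a `G`-algebra, i.e. an algebra `B` with an action `α` of `G` by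
algebra automorphisms. -/
def algRepresentation (α : G →* (B ≃ₐ[k] B)) : Representation k G B where
  toFun g := (α g).toLinearMap
  map_one' := by ext; simp
  map_mul' _ _ := by ext; simp

/-- A `G`-algebra as an object of the category of representations of `G`. -/
def algRep (α : G →* (B ≃ₐ[k] B)) : Rep.{u} k G := Rep.of (algRepresentation α)

/-- The unit `k → B` as a morphism of representations. -/
def algRepOne (α : G →* (B ≃ₐ[k] B)) : 𝟙_ (Rep.{u} k G) ⟶ algRep α :=
  Rep.ofHom (ρ := Representation.trivial k G k) (σ := algRepresentation α)
    ⟨Algebra.linearMap k B, fun g => by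
      ext; simp [algRepresentation]⟩

/-- The multiplication `B ⊗ B → B` as a morphism of representations. -/
def algRepMul (α : G →* (B ≃ₐ[k] B)) : algRep α ⊗ algRep α ⟶ algRep α :=
  Rep.ofHom (ρ := (algRepresentation α).tprod (algRepresentation α)) (σ := algRepresentation α)
    ⟨LinearMap.mul' k B, fun g => by
      ext; simp [algRepresentation]⟩

/-- A `G`-algebra is an algebra in the category of representations of `G`. -/
instance algRepMonObj (α : G →* (B ≃ₐ[k] B)) : MonObj (algRep α) where
  one := algRepOne α
  mul := algRepMul α
  one_mul := by
    ext1; ext1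
    refine TensorProduct.ext' fun x y => ?_
    exact (Algebra.smul_def (A := B) x y).symm
  mul_one := by
    ext1; ext1
    refine TensorProduct.ext' fun x y => ?_
    exact ((Algebra.smul_def (A := B) y x).trans (Algebra.commutes (A := B) y x)).symm
  mul_assoc := by
    ext1; ext1
    refine TensorProduct.ext_threefold fun x y z => ?_
    exact mul_assoc (G := B) x y z

end GAlgebra

/-! ### The category `𝒵(G)`: graded representations as objects of the monoidal centre -/

section Graded

open scoped Classical in
/-- A grading `X = ⨁ X_g` of a representation `X` of `G` by `G` that is compatible with the
action: `f(X_g) = X_{f g f⁻¹}`. -/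
structure IsCompatibleGrading {k G : Type u} [Field k] [Group G] (X : Rep.{u} k G)
    (gr : G → Submodule k X.V) : Prop where
  isInternal : DirectSum.IsInternal gr
  compat : ∀ f g : G, (gr g).map (X.ρ f) = gr (f * g * f⁻¹)

variable {k G : Type u} [Field k] [Group G] {X : Rep.{u} k G} {gr : G → Submodule k X.V}

namespace IsCompatibleGrading

theorem mem (h : IsCompatibleGrading X gr) (f g : G) {x : X.V} (hx : x ∈ gr g) :
    X.ρ f x ∈ gr (f * g * f⁻¹) := by
  rw [← h.compat]; exact Submodule.mem_map_of_mem hx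

theorem hom_ext (h : IsCompatibleGrading X gr) {M : Type u} [AddCommGroup M] [Module k M]
    {φ ψ : X.V →ₗ[k] M} (H : ∀ g, ∀ x ∈ gr g, φ x = ψ x) : φ = ψ := by
  classical
  have ht : ∀ x : X.V, x ∈ ⨆ g, gr g := fun x => by
    rw [h.isInternal.submodule_iSup_eq_top]; trivial
  ext x
  induction ht x using Submodule.iSup_induction' with
  | mem i x hx => exact H i x hx
  | zero => simp
  | add x y _ _ hx hy => simp [hx, hy]

open scoped Classical in
/-- The linear map on `X` which is given by `φ g` on the component `X_g`. -/
def glue (h : IsCompatibleGrading X gr) {M : Type u} [AddCommGroup M] [Module k M]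
    (φ : G → (X.V →ₗ[k] M)) : X.V →ₗ[k] M :=
  (DirectSum.toModule k G M fun g => (φ g).comp (gr g).subtype).comp
    (LinearEquiv.ofBijective (DirectSum.coeLinearMap gr) h.isInternal).symm.toLinearMap

theorem glue_apply (h : IsCompatibleGrading X gr) {M : Type u} [AddCommGroup M] [Module k M]
    (φ : G → (X.V →ₗ[k] M)) (g : G) {x : X.V} (hx : x ∈ gr g) : h.glue φ x = φ g x := by
  classical
  have : (LinearEquiv.ofBijective (DirectSum.coeLinearMap gr) h.isInternal).symm x
      = DirectSum.lof k G (fun g => gr g) g ⟨x, hx⟩ := by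
    rw [LinearEquiv.symm_apply_eq]
    exact (DirectSum.coeLinearMap_lof gr g ⟨x, hx⟩).symm
  simp only [glue, LinearMap.comp_apply, LinearEquiv.coe_coe]
  erw [this]
  simp

/-- `x ⊗ u ↦ g(u) ⊗ x` for `x ∈ X_g`. -/
def braidFun (h : IsCompatibleGrading X gr) (U : Rep.{u} k G) : X.V ⊗[k] U.V →ₗ[k] U.V ⊗[k] X.V :=
  TensorProduct.lift (h.glue fun g => ((TensorProduct.mk k U.V X.V).comp (U.ρ g)).flip)

/-- `u ⊗ x ↦ x ⊗ g⁻¹(u)` for `x ∈ X_g`. -/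
def braidInv (h : IsCompatibleGrading X gr) (U : Rep.{u} k G) : U.V ⊗[k] X.V →ₗ[k] X.V ⊗[k] U.V :=
  TensorProduct.lift
    (h.glue fun g => ((TensorProduct.mk k X.V U.V).flip.comp (U.ρ g⁻¹)).flip).flip

theorem braidFun_tmul (h : IsCompatibleGrading X gr) (U : Rep.{u} k G) (g : G) {x : X.V}
    (hx : x ∈ gr g) (y : U.V) : h.braidFun U (x ⊗ₜ y) = U.ρ g y ⊗ₜ x := by
  simp [braidFun, h.glue_apply _ g hx]

theorem braidInv_tmul (h : IsCompatibleGrading X gr) (U : Rep.{u} k G) (g : G) {x : X.V}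
    (hx : x ∈ gr g) (y : U.V) : h.braidInv U (y ⊗ₜ x) = x ⊗ₜ U.ρ g⁻¹ y := by
  simp [braidInv, h.glue_apply _ g hx]

theorem tensor_ext (h : IsCompatibleGrading X gr) {M N : Type u} [AddCommGroup M] [Module k M]
    [AddCommGroup N] [Module k N]
    {φ ψ : X.V ⊗[k] N →ₗ[k] M} (H : ∀ g, ∀ x ∈ gr g, ∀ y, φ (x ⊗ₜ y) = ψ (x ⊗ₜ y)) : φ = ψ :=
  TensorProduct.ext (h.hom_ext fun g x hx => LinearMap.ext fun y => H g x hx y)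

theorem tensor_ext_right (h : IsCompatibleGrading X gr) {M N : Type u} [AddCommGroup M]
    [Module k M] [AddCommGroup N] [Module k N]
    {φ ψ : N ⊗[k] X.V →ₗ[k] M} (H : ∀ g, ∀ x ∈ gr g, ∀ y, φ (y ⊗ₜ x) = ψ (y ⊗ₜ x)) : φ = ψ :=
  TensorProduct.ext (LinearMap.ext fun y => h.hom_ext fun g x hx => H g x hx y)

/-- The isomorphism `X ⊗ U ≅ U ⊗ X`, `x ⊗ u ↦ g(u) ⊗ x` for `x ∈ X_g`, in the category of
representations. -/
def braidIso (h : IsCompatibleGrading X gr) (U : Rep.{u} k G) : X ⊗ U ≅ U ⊗ X where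
  hom := Rep.ofHom (ρ := X.ρ.tprod U.ρ) (σ := U.ρ.tprod X.ρ) ⟨h.braidFun U, fun f => by
    refine h.tensor_ext fun g x hx y => ?_
    simp [h.braidFun_tmul U g hx, h.braidFun_tmul U _ (h.mem f g hx)]⟩
  inv := Rep.ofHom (ρ := U.ρ.tprod X.ρ) (σ := X.ρ.tprod U.ρ) ⟨h.braidInv U, fun f => by
    refine h.tensor_ext_right fun g x hx y => ?_
    simp [h.braidInv_tmul U g hx, h.braidInv_tmul U _ (h.mem f g hx), mul_assoc]⟩
  hom_inv_id := by
    ext1; ext1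
    refine h.tensor_ext fun g x hx y => ?_
    change h.braidInv U (h.braidFun U (x ⊗ₜ y)) = x ⊗ₜ y
    simp [h.braidFun_tmul U g hx, h.braidInv_tmul U g hx]
  inv_hom_id := by
    ext1; ext1
    refine h.tensor_ext_right fun g x hx y => ?_
    change h.braidFun U (h.braidInv U (y ⊗ₜ x)) = y ⊗ₜ x
    simp [h.braidFun_tmul U g hx, h.braidInv_tmul U g hx]

/-- The half braiding `x ⊗ u ↦ g(u) ⊗ x` (`x ∈ X_g`) of a representation with a compatible
grading. -/
def halfBraiding (h : IsCompatibleGrading X gr) : HalfBraiding X where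
  β U := h.braidIso U
  monoidal U U' := by
    ext1; ext1
    refine h.tensor_ext fun g x hx w => ?_
    induction w using TensorProduct.induction_on with
    | zero => simp
    | add a b ha hb => rw [TensorProduct.tmul_add, map_add, map_add, ha, hb]
    | tmul y z =>
      change h.braidFun (U ⊗ U') (x ⊗ₜ (y ⊗ₜ z)) =
        (TensorProduct.assoc k U.V U'.V X.V).symm ((h.braidFun U').lTensor U.V
          (TensorProduct.assoc k U.V X.V U'.V ((h.braidFun U).rTensor U'.V ((x ⊗ₜ y) ⊗ₜ z))))
      rw [h.braidFun_tmul (U ⊗ U') g hx, LinearMap.rTensor_tmul, h.braidFun_tmul U g hx,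
        TensorProduct.assoc_tmul, LinearMap.lTensor_tmul, h.braidFun_tmul U' g hx]
      rfl
  naturality {U U'} f := by
    ext1; ext1
    refine h.tensor_ext fun g x hx y => ?_
    change h.braidFun U' (x ⊗ₜ f.hom y) = f.hom.toLinearMap.rTensor X.V (h.braidFun U (x ⊗ₜ y))
    rw [h.braidFun_tmul U' g hx, h.braidFun_tmul U g hx, LinearMap.rTensor_tmul]
    exact congrArg (· ⊗ₜ[k] x) (Rep.hom_comm_apply f g y).symm

/-- The object of the monoidal centre of the category of representations of `G` corresponding to a
`G`-graded vector space with a compatible `G`-action. -/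
def centerObj (h : IsCompatibleGrading X gr) : Center (Rep.{u} k G) := ⟨X, h.halfBraiding⟩

end IsCompatibleGrading

end Graded

section GradedAlgebra

variable {k G : Type u} [Field k] [Group G] {B : Type u} [Ring B] [Algebra k B]

/-- A `G`-graded algebra structure on the `G`-algebra `(B, α)`, with compatible grading: an algebra
in the category `𝒵(G)`. -/
structure IsZAlgebra (α : G →* (B ≃ₐ[k] B)) (gr : G → Submodule k B) : Prop where
  grading : IsCompatibleGrading (algRep α) gr
  one_mem : (1 : B) ∈ gr 1
  mul_mem : ∀ f g x y, x ∈ gr f → y ∈ gr g → x * y ∈ gr (f * g)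

namespace IsZAlgebra

variable {α : G →* (B ≃ₐ[k] B)} {gr : G → Submodule k B}

/-- An algebra of `𝒵(G)` as an object of the monoidal centre of the category of representations. -/
def center (h : IsZAlgebra α gr) : Center (Rep.{u} k G) := h.grading.centerObj

theorem mul_comm_braid (h : IsZAlgebra α gr) (U : Rep.{u} k G) :
    (h.grading.braidFun U).comp ((LinearMap.mul' k B).rTensor U.V) =
      ((LinearMap.mul' k B).lTensor U.V).comp
        ((TensorProduct.assoc k U.V B B).toLinearMap.comp
          (((h.grading.braidFun U).rTensor B).comp
            ((TensorProduct.assoc k B U.V B).symm.toLinearMap.comp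
              (((h.grading.braidFun U).lTensor B).comp
                (TensorProduct.assoc k B B U.V).toLinearMap)))) := by
  refine TensorProduct.ext_threefold fun (x : B) (y : B) u => ?_
  refine LinearMap.congr_fun (h.grading.hom_ext
    (φ := LinearMap.comp (LinearMap.comp (h.grading.braidFun U)
        ((LinearMap.mul' k B).rTensor U.V))
      (((TensorProduct.mk k (B ⊗[k] B) U.V).flip u).comp ((TensorProduct.mk k B B).flip y)))
    (ψ := LinearMap.comp (LinearMap.comp ((LinearMap.mul' k B).lTensor U.V)
        ((TensorProduct.assoc k U.V B B).toLinearMap.comp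
          (((h.grading.braidFun U).rTensor B).comp
            ((TensorProduct.assoc k B U.V B).symm.toLinearMap.comp
              (((h.grading.braidFun U).lTensor B).comp
                (TensorProduct.assoc k B B U.V).toLinearMap)))))
      (((TensorProduct.mk k (B ⊗[k] B) U.V).flip u).comp ((TensorProduct.mk k B B).flip y)))
    fun f (x : B) hx => ?_) x
  refine LinearMap.congr_fun (h.grading.hom_ext
    (φ := LinearMap.comp (LinearMap.comp (h.grading.braidFun U)
        ((LinearMap.mul' k B).rTensor U.V))
      (((TensorProduct.mk k (B ⊗[k] B) U.V).flip u).comp (TensorProduct.mk k B B x)))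
    (ψ := LinearMap.comp (LinearMap.comp ((LinearMap.mul' k B).lTensor U.V)
        ((TensorProduct.assoc k U.V B B).toLinearMap.comp
          (((h.grading.braidFun U).rTensor B).comp
            ((TensorProduct.assoc k B U.V B).symm.toLinearMap.comp
              (((h.grading.braidFun U).lTensor B).comp
                (TensorProduct.assoc k B B U.V).toLinearMap)))))
      (((TensorProduct.mk k (B ⊗[k] B) U.V).flip u).comp (TensorProduct.mk k B B x)))
    fun g (y : B) hy => ?_) y
  change h.grading.braidFun U ((x * y) ⊗ₜ u) = ((LinearMap.mul' k B).lTensor U.V)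
    (TensorProduct.assoc k U.V B B ((h.grading.braidFun U).rTensor B
      ((TensorProduct.assoc k B U.V B).symm (x ⊗ₜ (h.grading.braidFun U (y ⊗ₜ u))))))
  rw [h.grading.braidFun_tmul U (f * g) (h.mul_mem f g x y hx hy),
    h.grading.braidFun_tmul U g hy]
  change _ = ((LinearMap.mul' k B).lTensor U.V)
    (TensorProduct.assoc k U.V B B ((h.grading.braidFun U (x ⊗ₜ (U.ρ g u))) ⊗ₜ y))
  rw [h.grading.braidFun_tmul U f hx]
  change _ = U.ρ f (U.ρ g u) ⊗ₜ (x * y)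
  rw [map_mul]; rfl

/-- An algebra of `𝒵(G)` as an algebra in the monoidal centre of the category of representations
of `G`; unit and multiplication are those of the algebra. -/
instance monObj (h : IsZAlgebra α gr) : MonObj h.center where
  one := ⟨algRepOne α, fun U => by
    ext1; ext1
    refine TensorProduct.ext' fun (x : k) (y : U.V) => ?_
    change h.grading.braidFun U (algebraMap k B x ⊗ₜ y) =
      (Algebra.linearMap k B).lTensor U.V ((TensorProduct.rid k U.V).symm (x • y))
    refine (h.grading.braidFun_tmul U 1 (by
      rw [Algebra.algebraMap_eq_smul_one]; exact (gr 1).smul_mem _ h.one_mem) y).trans ?_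
    rw [TensorProduct.rid_symm_apply, LinearMap.lTensor_tmul, TensorProduct.smul_tmul, map_one,
      Algebra.linearMap_apply, Algebra.algebraMap_eq_smul_one, map_one]
    rfl⟩
  mul := ⟨algRepMul α, fun U => by
    ext1; ext1
    exact h.mul_comm_braid U⟩
  one_mul := Center.ext _ _ (MonObj.one_mul (algRep α))
  mul_one := Center.ext _ _ (MonObj.mul_one (algRep α))
  mul_assoc := Center.ext _ _ (MonObj.mul_assoc (algRep α))

end IsZAlgebra

end GradedAlgebra

/-! ### Twisted group algebras and projective representations -/

/-- A 2-cocycle of the group `H` with values in `kˣ` (with trivial action). It is not required to be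
normalised. -/
structure TwoCocycle (k H : Type u) [Field k] [Group H] where
  /-- the underlying function -/
  toFun : H → H → kˣ
  cocycle : ∀ f g h, toFun f g * toFun (f * g) h = toFun g h * toFun f (g * h)

namespace TwoCocycle

variable {k H : Type u} [Field k] [Group H] (γ : TwoCocycle k H)

instance : CoeFun (TwoCocycle k H) (fun _ => H → H → kˣ) := ⟨toFun⟩

theorem one_left (f : H) : γ 1 f = γ 1 1 := by
  have := γ.cocycle 1 1 f
  simp only [one_mul] at this
  rw [mul_comm] at this
  exact (mul_left_cancel this).symm

theorem one_right (f : H) : γ f 1 = γ 1 1 := by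
  have := γ.cocycle f 1 1
  simp only [mul_one] at this
  exact mul_right_cancel this

/-- The function `ε_h(f)`, determined by `e_h e_f e_h⁻¹ = ε_h(f) e_{hfh⁻¹}` in `k[H, γ]`. -/
def eps (h f : H) : kˣ := γ h f * (γ (h * f * h⁻¹) h)⁻¹

end TwoCocycle

/-- The skew group algebra `k[H, γ]`: the vector space with basis `e_h`, `h ∈ H`, and with
multiplication `e_f e_g = γ(f, g) e_{fg}`. -/
def SkewGroupAlgebra {k H : Type u} [Field k] [Group H] (_γ : TwoCocycle k H) : Type u := H →₀ k

namespace SkewGroupAlgebra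

variable {k H : Type u} [Field k] [Group H] (γ : TwoCocycle k H)

instance : AddCommGroup (SkewGroupAlgebra γ) := inferInstanceAs (AddCommGroup (H →₀ k))

instance : Module k (SkewGroupAlgebra γ) := inferInstanceAs (Module k (H →₀ k))

/-- The basis elements `e_h`. -/
def e (h : H) : SkewGroupAlgebra γ := Finsupp.single h (1 : k)

theorem lin_ext {M : Type u} [AddCommGroup M] [Module k M] {φ ψ : SkewGroupAlgebra γ →ₗ[k] M}
    (w : ∀ h, φ (e γ h) = ψ (e γ h)) : φ = ψ :=
  Finsupp.lhom_ext' fun h => LinearMap.ext_ring (w h)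

/-- The linear map with prescribed values on the basis `e_h`. -/
def lift {M : Type u} [AddCommGroup M] [Module k M] (v : H → M) : SkewGroupAlgebra γ →ₗ[k] M :=
  Finsupp.linearCombination k v

theorem lift_e {M : Type u} [AddCommGroup M] [Module k M] (v : H → M) (h : H) :
    lift γ v (e γ h) = v h := by
  refine (Finsupp.linearCombination_single k (1 : k) h).trans (one_smul k _)

/-- The bilinear multiplication of `k[H, γ]`. -/
def mulL : SkewGroupAlgebra γ →ₗ[k] SkewGroupAlgebra γ →ₗ[k] SkewGroupAlgebra γ :=
  lift γ fun f => lift γ fun g => (γ f g : k) • e γ (f * g)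

theorem mulL_e (f g : H) : mulL γ (e γ f) (e γ g) = (γ f g : k) • e γ (f * g) := by
  simp [mulL, lift_e]

theorem mulL_assoc (x y z : SkewGroupAlgebra γ) :
    mulL γ (mulL γ x y) z = mulL γ x (mulL γ y z) := by
  have h1 : ∀ f g, (mulL γ) (mulL γ (e γ f) (e γ g)) =
      (mulL γ (e γ f)).comp (mulL γ (e γ g)) := fun f g => by
    refine lin_ext γ fun h => ?_
    have := γ.cocycle f g h
    simp [mulL_e, smul_smul, mul_assoc, ← Units.val_mul, this]
  have h2 : ∀ f, (mulL γ).comp (mulL γ (e γ f)) =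
      (LinearMap.llcomp k _ _ _ (mulL γ (e γ f))).comp (mulL γ) := fun f =>
    lin_ext γ fun g => h1 f g
  have h3 : (mulL γ).compr₂ (mulL γ) =
      ((LinearMap.lcomp k _ (mulL γ)).comp ((LinearMap.llcomp k _ _ _).comp (mulL γ))) :=
    lin_ext γ fun f => h2 f
  exact LinearMap.congr_fun (LinearMap.congr_fun (LinearMap.congr_fun h3 x) y) z

/-- The unit `γ(1, 1)⁻¹ e_1` of `k[H, γ]`. -/
def one : SkewGroupAlgebra γ := ((γ 1 1)⁻¹ : kˣ) • e γ 1

theorem one_mulL (x : SkewGroupAlgebra γ) : mulL γ (one γ) x = x := by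
  have : mulL γ (one γ) = LinearMap.id := lin_ext γ fun f => by
    simp [one, mulL_e, γ.one_left, Units.smul_def]
  rw [this]; rfl

theorem mulL_one (x : SkewGroupAlgebra γ) : mulL γ x (one γ) = x := by
  have : (mulL γ).flip (one γ) = LinearMap.id := lin_ext γ fun f => by
    simp [one, mulL_e, γ.one_right, Units.smul_def]
  exact LinearMap.congr_fun this x

instance : Ring (SkewGroupAlgebra γ) :=
  { (inferInstance : AddCommGroup (SkewGroupAlgebra γ)) with
    mul := fun x y => mulL γ x y
    one := one γ
    mul_assoc := mulL_assoc γ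
    one_mul := one_mulL γ
    mul_one := mulL_one γ
    left_distrib := fun x y z => map_add (mulL γ x) y z
    right_distrib := fun x y z => LinearMap.map_add₂ (mulL γ) x y z
    zero_mul := fun x => LinearMap.map_zero₂ (mulL γ) x
    mul_zero := fun x => map_zero (mulL γ x) }

instance : Algebra k (SkewGroupAlgebra γ) :=
  Algebra.ofModule (fun r x y => LinearMap.map_smul₂ (mulL γ) r x y)
    (fun r x y => map_smul (mulL γ x) r y)

theorem e_mul_e (f g : H) : e γ f * e γ g = (γ f g : k) • e γ (f * g) := mulL_e γ f g

theorem one_def : (1 : SkewGroupAlgebra γ) = ((γ 1 1)⁻¹ : kˣ) • e γ 1 := rfl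

theorem e_one : e γ 1 = (γ 1 1 : k) • (1 : SkewGroupAlgebra γ) := by
  simp [one_def, Units.smul_def]

/-- The element `e_h` as an invertible element of `k[H, γ]`. -/
def unit (h : H) : (SkewGroupAlgebra γ)ˣ where
  val := e γ h
  inv := ((γ h h⁻¹ : k)⁻¹ * (γ 1 1 : k)⁻¹) • e γ h⁻¹
  val_inv := by
    rw [mul_smul_comm, e_mul_e, mul_inv_cancel, e_one, smul_smul, smul_smul]
    field_simp
    simp
  inv_val := by
    have : γ h⁻¹ h = γ h h⁻¹ := by
      have := γ.cocycle h h⁻¹ h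
      rw [mul_inv_cancel, inv_mul_cancel, γ.one_left, γ.one_right h] at this
      exact (mul_right_cancel this).symm
    rw [smul_mul_assoc, e_mul_e, inv_mul_cancel, e_one, smul_smul, smul_smul, this]
    field_simp
    simp

theorem unit_val (h : H) : (unit γ h : SkewGroupAlgebra γ) = e γ h := rfl

theorem e_smul_inj {a b : k} {f : H} (h : a • e γ f = b • e γ f) : a = b := by
  have := DFunLike.congr_fun (F := H →₀ k) h f
  change a * (Finsupp.single f (1 : k)) f = b * (Finsupp.single f (1 : k)) f at this
  simpa using this

end SkewGroupAlgebra

namespace TwoCocycle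

open SkewGroupAlgebra

variable {k H : Type u} [Field k] [Group H] (γ : TwoCocycle k H)

theorem e_conj (h f : H) :
    e γ h * e γ f = (γ.eps h f : k) • (e γ (h * f * h⁻¹) * e γ h) := by
  rw [e_mul_e, e_mul_e, smul_smul, inv_mul_cancel_right]
  simp [eps]

theorem eps_one_right (h : H) : γ.eps h 1 = 1 := by
  simp [eps, γ.one_left, γ.one_right]

theorem eps_mul_left (h h' f : H) :
    γ.eps (h * h') f = γ.eps h' f * γ.eps h (h' * f * h'⁻¹) := by
  have h1 : e γ h * e γ h' * e γ f = (γ.eps h' f * γ.eps h (h' * f * h'⁻¹) : k) •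
      (e γ (h * h' * f * (h * h')⁻¹) * (e γ h * e γ h')) := by
    rw [mul_assoc, e_conj, mul_smul_comm, ← mul_assoc, e_conj, smul_mul_assoc, smul_smul,
      mul_assoc (e γ _)]
    simp [mul_assoc]
  rw [e_mul_e, smul_mul_assoc, e_conj, mul_smul_comm, smul_comm] at h1
  rw [e_mul_e] at h1
  simp only [smul_smul] at h1
  have h3 := e_smul_inj γ h1
  ext
  push_cast
  refine mul_right_cancel₀ (Units.ne_zero (γ h h')) (mul_right_cancel₀ (Units.ne_zero
    (γ (h * h' * f * (h * h')⁻¹) (h * h'))) ?_)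
  linear_combination h3

theorem eps_mul_right (h f f' : H) :
    (γ f f' : k) * γ.eps h (f * f') =
      γ.eps h f * γ.eps h f' * γ (h * f * h⁻¹) (h * f' * h⁻¹) := by
  have h1 : e γ h * (e γ f * e γ f') = (γ.eps h f * γ.eps h f' : k) •
      (e γ (h * f * h⁻¹) * e γ (h * f' * h⁻¹) * e γ h) := by
    rw [← mul_assoc, e_conj, smul_mul_assoc, mul_assoc, e_conj, mul_smul_comm, smul_smul,
      ← mul_assoc (e γ (h * f * h⁻¹))]
  have hc : h * f * h⁻¹ * (h * f' * h⁻¹) = h * (f * f') * h⁻¹ := by group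
  rw [e_mul_e, mul_smul_comm, e_conj, e_mul_e γ (h * f * h⁻¹), hc, smul_mul_assoc, e_mul_e] at h1
  simp only [smul_smul] at h1
  have h3 := e_smul_inj γ h1
  refine mul_right_cancel₀ (Units.ne_zero (γ (h * (f * f') * h⁻¹) h)) ?_
  linear_combination h3

end TwoCocycle

section ProjectiveRep

variable {k H : Type u} [Field k] [Group H] {γ : TwoCocycle k H} {V : Type u} [AddCommGroup V]
  [Module k V]

/-- A homomorphism of algebras `ρ : k[H, γ] → End(V)`, i.e. a projective representation of `H` with
Schur multiplier `γ`, is irreducible if `V` is non-zero and the centraliser of the image of `ρ` in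
`End(V)` consists of the scalars. -/
def IsIrreducibleProjective (ρ : SkewGroupAlgebra γ →ₐ[k] Module.End k V) : Prop :=
  Nontrivial V ∧ Subalgebra.centralizer k (Set.range ρ) = ⊥

/-- Conjugation `x ↦ u x u⁻¹` by an invertible element of an algebra. -/
def conjAut {B : Type u} [Ring B] [Algebra k B] (u : Bˣ) : B ≃ₐ[k] B where
  toFun x := u * x * ↑u⁻¹
  invFun x := ↑u⁻¹ * x * u
  left_inv x := by simp [mul_assoc]
  right_inv x := by simp [mul_assoc]
  map_mul' x y := by simp [mul_assoc]
  map_add' x y := by simp [mul_add, add_mul]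
  commutes' r := by simp [← Algebra.commutes r (u : B), mul_assoc]

/-- The invertible operator `ρ(e_h)`. -/
def projUnit (ρ : SkewGroupAlgebra γ →ₐ[k] Module.End k V) (h : H) : (Module.End k V)ˣ :=
  Units.map (ρ : SkewGroupAlgebra γ →* Module.End k V) (SkewGroupAlgebra.unit γ h)

theorem projUnit_mul (ρ : SkewGroupAlgebra γ →ₐ[k] Module.End k V) (f g : H) :
    (projUnit ρ f : Module.End k V) * projUnit ρ g = (γ f g : k) • ↑(projUnit ρ (f * g)) := by
  change ρ (SkewGroupAlgebra.e γ f) * ρ (SkewGroupAlgebra.e γ g) =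
    (γ f g : k) • ρ (SkewGroupAlgebra.e γ (f * g))
  rw [← map_mul, SkewGroupAlgebra.e_mul_e, map_smul]

theorem conjAut_of_smul {B : Type u} [Ring B] [Algebra k B] (u v : Bˣ) (c : kˣ)
    (h : (u : B) = (c : k) • v) : conjAut (k := k) u = conjAut v := by
  ext x
  have h1 : (u : B) * x * ↑u⁻¹ = v * x * ↑v⁻¹ := by
    rw [Units.mul_inv_eq_iff_eq_mul, h]
    simp [mul_assoc]
  exact h1

theorem conjAut_mul {B : Type u} [Ring B] [Algebra k B] (u v : Bˣ) :
    conjAut (k := k) (u * v) = conjAut u * conjAut v := by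
  ext x
  have : ((u * v : Bˣ) : B) * x * ↑(u * v)⁻¹ = u * (v * x * ↑v⁻¹) * ↑u⁻¹ := by
    simp [mul_assoc]
  exact this

/-- The `H`-algebra structure on `End(V)` for a projective representation `V` of `H`:
`h(x) = ρ(e_h) x ρ(e_h)⁻¹`. -/
def endAction (ρ : SkewGroupAlgebra γ →ₐ[k] Module.End k V) :
    H →* (Module.End k V ≃ₐ[k] Module.End k V) :=
  MonoidHom.mk' (fun h => conjAut (projUnit ρ h)) fun f g => by
    rw [← conjAut_mul]
    refine (conjAut_of_smul _ _ (γ f g) ?_).symm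
    rw [Units.val_mul, projUnit_mul]

end ProjectiveRep

/-! ### Induced algebras -/

section Induced

variable {k G : Type u} [Field k] [Group G] {H : Subgroup G} {B : Type u} [Ring B] [Algebra k B]

/-- The algebra induced from an `H`-algebra `B`: functions `a : G → B` with `a(hg) = h(a(g))` for
`h ∈ H`, with pointwise operations. -/
def indAlgebra (β : H →* (B ≃ₐ[k] B)) : Subalgebra k (G → B) where
  carrier := {a | ∀ (h : H) (g : G), a (h * g) = β h (a g)}
  mul_mem' ha hb h g := by simp [ha h g, hb h g]
  one_mem' h g := by simp
  add_mem' ha hb h g := by simp [ha h g, hb h g]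
  zero_mem' h g := by simp
  algebraMap_mem' r h g := by simp

/-- Right translation by `f`, `f(a)(g) = a(gf)`. -/
def indTranslate (β : H →* (B ≃ₐ[k] B)) (f : G) : indAlgebra β →ₐ[k] indAlgebra β where
  toFun a := ⟨fun g => a.1 (g * f), fun h g =>
    (congrArg a.1 (mul_assoc (h : G) g f)).trans (a.2 h (g * f))⟩
  map_one' := rfl
  map_mul' _ _ := rfl
  map_zero' := rfl
  map_add' _ _ := rfl
  commutes' _ := rfl

theorem indTranslate_apply (β : H →* (B ≃ₐ[k] B)) (f : G) (a : indAlgebra β) (g : G) :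
    (indTranslate β f a).1 g = a.1 (g * f) := rfl

/-- The `G`-algebra structure `f(a)(g) = a(gf)` on the induced algebra. -/
def indAction (β : H →* (B ≃ₐ[k] B)) : G →* (indAlgebra β ≃ₐ[k] indAlgebra β) where
  toFun f := AlgEquiv.ofAlgHom (indTranslate β f) (indTranslate β f⁻¹)
    (AlgHom.ext fun a => Subtype.ext <| funext fun g => by
      simp [indTranslate_apply])
    (AlgHom.ext fun a => Subtype.ext <| funext fun g => by
      simp [indTranslate_apply])
  map_one' := AlgEquiv.ext fun a => Subtype.ext <| funext fun g =>
    congrArg a.1 (mul_one g)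
  map_mul' f f' := AlgEquiv.ext fun a => Subtype.ext <| funext fun g =>
    congrArg a.1 (mul_assoc g f f').symm

theorem indAction_apply (β : H →* (B ≃ₐ[k] B)) (f : G) (a : indAlgebra β) (g : G) :
    (indAction β f a).1 g = a.1 (g * f) := rfl

end Induced

/-- The `G`-algebra `A(H, γ) = ind_H^G End(V)`, as an object (in fact an algebra, by
`algRepMonObj`) of the category of representations of `G`. -/
abbrev inducedEndAlgebra {k G : Type u} [Field k] [Group G] {H : Subgroup G} {γ : TwoCocycle k H}
    {V : Type u} [AddCommGroup V] [Module k V] (ρ : SkewGroupAlgebra γ →ₐ[k] Module.End k V) :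
    Rep.{u} k G :=
  algRep (indAction (endAction ρ))

/-! ### The algebra `A(H, H, γ)` -/

section AHH

variable {k G : Type u} [Field k] [Group G] {H : Subgroup G}

/-- The subspace spanned by the relations `a_{gh,f} = ε_h(f) a_{g,hfh⁻¹}`. -/
def zAlgebraRelations (γ : TwoCocycle k H) : Submodule k (G × H →₀ k) :=
  Submodule.span k (Set.range fun p : G × H × H =>
    Finsupp.single (p.1 * p.2.1, p.2.2) (1 : k) -
      (γ.eps p.2.1 p.2.2 : k) • Finsupp.single (p.1, p.2.1 * p.2.2 * p.2.1⁻¹) (1 : k))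

/-- The vector space `A(H, H, γ)`, spanned by `a_{g,f}`, `g ∈ G`, `f ∈ H`, modulo the relations
`a_{gh,f} = ε_h(f) a_{g,hfh⁻¹}`, `h ∈ H`. -/
def ZAlgebra (γ : TwoCocycle k H) : Type u := (G × H →₀ k) ⧸ zAlgebraRelations γ

namespace ZAlgebra

variable (γ : TwoCocycle k H)

instance : AddCommGroup (ZAlgebra γ) :=
  inferInstanceAs (AddCommGroup ((G × H →₀ k) ⧸ zAlgebraRelations γ))

instance : Module k (ZAlgebra γ) :=
  inferInstanceAs (Module k ((G × H →₀ k) ⧸ zAlgebraRelations γ))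

/-- The spanning elements `a_{g,f}`. -/
def a (g : G) (f : H) : ZAlgebra γ := (zAlgebraRelations γ).mkQ (Finsupp.single (g, f) 1)

theorem a_rel (g : G) (h f : H) :
    a γ (g * h) f = (γ.eps h f : k) • a γ g (h * f * h⁻¹) := by
  refine Eq.trans ?_ ((zAlgebraRelations γ).mkQ.map_smul _ _)
  refine (Submodule.Quotient.eq _).2 (Submodule.subset_span ⟨(g, h, f), rfl⟩)

theorem lin_ext {M : Type u} [AddCommGroup M] [Module k M] {φ ψ : ZAlgebra γ →ₗ[k] M}
    (w : ∀ g f, φ (a γ g f) = ψ (a γ g f)) : φ = ψ :=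
  Submodule.linearMap_qext _ (Finsupp.lhom_ext' fun p => LinearMap.ext_ring (w p.1 p.2))

/-- The linear map with prescribed values on the `a_{g,f}`, compatible with the relations. -/
def lift {M : Type u} [AddCommGroup M] [Module k M] (v : G → H → M)
    (hv : ∀ g (h f : H), v (g * h) f = (γ.eps h f : k) • v g (h * f * h⁻¹)) :
    ZAlgebra γ →ₗ[k] M :=
  (zAlgebraRelations γ).liftQ (Finsupp.linearCombination k fun p : G × H => v p.1 p.2) (by
    refine Submodule.span_le.2 ?_
    rintro _ ⟨⟨g, h, f⟩, rfl⟩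
    simp [hv])

theorem lift_a {M : Type u} [AddCommGroup M] [Module k M] (v : G → H → M)
    (hv : ∀ g (h f : H), v (g * h) f = (γ.eps h f : k) • v g (h * f * h⁻¹)) (g : G) (f : H) :
    lift γ v hv (a γ g f) = v g f := by
  refine ((zAlgebraRelations γ).liftQ_apply _ _).trans ?_
  simp

open scoped Classical in
/-- The value of the product `a_{g,f} a_{g',f'}`: it is zero if `gH ≠ g'H`, and if `g' = gh` with
`h ∈ H` it is computed from `a_{gh,f'} = ε_h(f') a_{g,hf'h⁻¹}` and
`a_{g,f} a_{g,f''} = γ(f,f'') a_{g,ff''}`. -/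
def mulBasis (g : G) (f : H) (g' : G) (f' : H) : ZAlgebra γ :=
  if h : g⁻¹ * g' ∈ H then
    (γ.eps ⟨_, h⟩ f' * γ f (⟨_, h⟩ * f' * ⟨_, h⟩⁻¹) : k) • a γ g (f * (⟨_, h⟩ * f' * ⟨_, h⟩⁻¹))
  else 0

theorem mulBasis_coe (g : G) (f h f' : H) : mulBasis γ g f (g * h) f' =
    (γ.eps h f' * γ f (h * f' * h⁻¹) : k) • a γ g (f * (h * f' * h⁻¹)) := by
  have h1 : g⁻¹ * (g * h) ∈ H := by simp
  have h2 : (⟨g⁻¹ * (g * h), h1⟩ : H) = h := by ext; simp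
  rw [mulBasis, dif_pos h1, h2]

theorem mulBasis_ne (g : G) (f : H) (g' : G) (f' : H) (h : g⁻¹ * g' ∉ H) :
    mulBasis γ g f g' f' = 0 := dif_neg h

theorem exists_coe {g g' : G} (h : g⁻¹ * g' ∈ H) : ∃ x : H, g' = g * x := ⟨⟨_, h⟩, by simp⟩

/-- The bilinear multiplication of `A(H, H, γ)`. -/
def mulL : ZAlgebra γ →ₗ[k] ZAlgebra γ →ₗ[k] ZAlgebra γ :=
  lift γ (fun g f => lift γ (fun g' f' => mulBasis γ g f g' f') fun g' h' f' => by
      by_cases hg : g⁻¹ * g' ∈ H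
      · obtain ⟨h, rfl⟩ := exists_coe hg
        have := mulBasis_coe γ g f (h * h') f'
        rw [Subgroup.coe_mul, ← mul_assoc] at this
        rw [this, mulBasis_coe, smul_smul, γ.eps_mul_left]
        have e : h * h' * f' * (h * h')⁻¹ = h * (h' * f' * h'⁻¹) * h⁻¹ := by group
        rw [e]; push_cast; rw [mul_assoc]
      · rw [mulBasis_ne γ _ _ _ _ hg, mulBasis_ne, smul_zero]
        rwa [← mul_assoc, Subgroup.mul_mem_cancel_right _ h'.2])
    fun g h f => by
      refine lin_ext γ fun g' f' => ?_
      rw [LinearMap.smul_apply, lift_a, lift_a]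
      by_cases hg : (g * h)⁻¹ * g' ∈ H
      · obtain ⟨h', rfl⟩ := exists_coe hg
        have := mulBasis_coe γ g (h * f * h⁻¹) (h * h') f'
        rw [Subgroup.coe_mul, ← mul_assoc] at this
        rw [this, mulBasis_coe, a_rel, smul_smul, smul_smul, γ.eps_mul_left]
        have e : h * h' * f' * (h * h')⁻¹ = h * (h' * f' * h'⁻¹) * h⁻¹ := by group
        have e' : h * (f * (h' * f' * h'⁻¹)) * h⁻¹ =
          (h * f * h⁻¹) * (h * (h' * f' * h'⁻¹) * h⁻¹) := by group
        rw [e, e']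
        congr 1
        push_cast
        linear_combination (γ.eps h' f' : k) * γ.eps_mul_right h f (h' * f' * h'⁻¹)
      · rw [mulBasis_ne γ _ _ _ _ hg, mulBasis_ne, smul_zero]
        rwa [mul_inv_rev, mul_assoc, Subgroup.mul_mem_cancel_left _ (H.inv_mem h.2)] at hg

theorem mulL_a (g : G) (f : H) (g' : G) (f' : H) :
    mulL γ (a γ g f) (a γ g' f') = mulBasis γ g f g' f' := by
  rw [mulL, lift_a, lift_a]

theorem mulL_a_same (g : G) (f f' : H) :
    mulL γ (a γ g f) (a γ g f') = (γ f f' : k) • a γ g (f * f') := by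
  have := mulBasis_coe γ g f 1 f'
  rw [mulL_a]
  simpa [TwoCocycle.eps, γ.one_left, γ.one_right] using this

theorem mulL_a_ne (g : G) (f : H) (g' : G) (f' : H) (h : g⁻¹ * g' ∉ H) :
    mulL γ (a γ g f) (a γ g' f') = 0 := by rw [mulL_a, mulBasis_ne γ _ _ _ _ h]

theorem mulL_assoc_a (g₁ g₂ g₃ : G) (f₁ f₂ f₃ : H) :
    mulL γ (mulL γ (a γ g₁ f₁) (a γ g₂ f₂)) (a γ g₃ f₃) =
      mulL γ (a γ g₁ f₁) (mulL γ (a γ g₂ f₂) (a γ g₃ f₃)) := by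
  by_cases h₂ : g₁⁻¹ * g₂ ∈ H
  · obtain ⟨x, rfl⟩ := exists_coe h₂
    by_cases h₃ : g₁⁻¹ * g₃ ∈ H
    · obtain ⟨y, rfl⟩ := exists_coe h₃
      rw [a_rel, a_rel]
      simp only [map_smul, LinearMap.smul_apply, mulL_a_same, smul_smul, mul_assoc f₁]
      congr 1
      have := congrArg (Units.val) (γ.cocycle f₁ (x * f₂ * x⁻¹) (y * f₃ * y⁻¹))
      push_cast at this
      linear_combination (γ.eps x f₂ : k) * γ.eps y f₃ * this
    · rw [a_rel]
      simp only [map_smul, LinearMap.smul_apply, mulL_a_same, mulL_a_ne γ _ _ _ _ h₃, smul_zero,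
        map_zero]
  · rw [mulL_a_ne γ _ _ _ _ h₂]
    by_cases h₃ : g₂⁻¹ * g₃ ∈ H
    · obtain ⟨y, rfl⟩ := exists_coe h₃
      rw [a_rel]
      simp only [map_smul, mulL_a_same, mulL_a_ne γ _ _ _ _ h₂, smul_zero, map_zero,
        LinearMap.zero_apply]
    · rw [mulL_a_ne γ _ _ _ _ h₃]; simp

theorem mulL_assoc (x y z : ZAlgebra γ) : mulL γ (mulL γ x y) z = mulL γ x (mulL γ y z) := by
  have h3 : (mulL γ).compr₂ (mulL γ) =
      ((LinearMap.lcomp k _ (mulL γ)).comp ((LinearMap.llcomp k _ _ _).comp (mulL γ))) :=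
    lin_ext γ fun _ _ => lin_ext γ fun _ _ => lin_ext γ fun _ _ => mulL_assoc_a γ _ _ _ _ _ _
  exact LinearMap.congr_fun (LinearMap.congr_fun (LinearMap.congr_fun h3 x) y) z

/-- The element `a_{g,1}`, which depends only on the coset `gH`. -/
def aCoset (q : G ⧸ H) : ZAlgebra γ :=
  Quotient.liftOn' q (fun g => a γ g 1) fun g g' h => by
    obtain ⟨x, rfl⟩ := exists_coe (QuotientGroup.leftRel_apply.1 h)
    rw [a_rel, γ.eps_one_right]; simp

variable [H.FiniteIndex]

/-- The unit `∑ γ(1,1)⁻¹ a_{g,1}`, where the sum is over (representatives of) the cosets `gH`. -/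
def one : ZAlgebra γ :=
  letI := Fintype.ofFinite (G ⧸ H)
  ((γ 1 1)⁻¹ : kˣ) • ∑ q : G ⧸ H, aCoset γ q

theorem one_mulL (x : ZAlgebra γ) : mulL γ (one γ) x = x := by
  let _ := Fintype.ofFinite (G ⧸ H)
  have : mulL γ (one γ) = LinearMap.id := lin_ext γ fun g f => by
    have h0 : ∀ q : G ⧸ H, q ≠ (g : G ⧸ H) → mulL γ (aCoset γ q) (a γ g f) = 0 := by
      intro q
      induction q using QuotientGroup.induction_on with
      | H g' => exact fun hne => mulL_a_ne γ _ _ _ _ fun h => hne (QuotientGroup.eq.2 h)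
    have h1 : mulL γ (aCoset γ (g : G ⧸ H)) (a γ g f) = (γ 1 f : k) • a γ g f := by
      have := mulL_a_same γ g 1 f
      rwa [one_mul] at this
    rw [one, Units.smul_def, map_smul, map_sum, LinearMap.smul_apply, LinearMap.sum_apply,
      Finset.sum_eq_single (g : G ⧸ H) (fun q _ => h0 q) (by simp), h1, γ.one_left f, smul_smul,
      Units.inv_mul, one_smul]
    rfl
  rw [this]; rfl

theorem mulL_one (x : ZAlgebra γ) : mulL γ x (one γ) = x := by
  let _ := Fintype.ofFinite (G ⧸ H)
  have : (mulL γ).flip (one γ) = LinearMap.id := lin_ext γ fun g f => by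
    have h0 : ∀ q : G ⧸ H, q ≠ (g : G ⧸ H) → mulL γ (a γ g f) (aCoset γ q) = 0 := by
      intro q
      induction q using QuotientGroup.induction_on with
      | H g' => exact fun hne => mulL_a_ne γ _ _ _ _ fun h => hne (QuotientGroup.eq.2 h).symm
    have h1 : mulL γ (a γ g f) (aCoset γ (g : G ⧸ H)) = (γ f 1 : k) • a γ g f := by
      have := mulL_a_same γ g f 1
      rwa [mul_one] at this
    rw [LinearMap.flip_apply, one, Units.smul_def, map_smul, map_sum,
      Finset.sum_eq_single (g : G ⧸ H) (fun q _ => h0 q) (by simp), h1, γ.one_right f, smul_smul,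
      Units.inv_mul, one_smul]
    rfl
  exact LinearMap.congr_fun this x

instance : Ring (ZAlgebra γ) :=
  { (inferInstance : AddCommGroup (ZAlgebra γ)) with
    mul := fun x y => mulL γ x y
    one := one γ
    mul_assoc := mulL_assoc γ
    one_mul := one_mulL γ
    mul_one := mulL_one γ
    left_distrib := fun x y z => map_add (mulL γ x) y z
    right_distrib := fun x y z => LinearMap.map_add₂ (mulL γ) x y z
    zero_mul := fun x => LinearMap.map_zero₂ (mulL γ) x
    mul_zero := fun x => map_zero (mulL γ x) }

instance : Algebra k (ZAlgebra γ) :=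
  Algebra.ofModule (fun r x y => LinearMap.map_smul₂ (mulL γ) r x y)
    (fun r x y => map_smul (mulL γ x) r y)

/-- The action of `G`, `g'(a_{g,f}) = a_{g'g,f}`, as linear maps. -/
def act (g' : G) : ZAlgebra γ →ₗ[k] ZAlgebra γ :=
  lift γ (fun g f => a γ (g' * g) f) fun g h f => by rw [← mul_assoc, a_rel]

theorem act_a (g' g : G) (f : H) : act γ g' (a γ g f) = a γ (g' * g) f := lift_a γ _ _ _ _

theorem act_mul (g' : G) (x y : ZAlgebra γ) : act γ g' (x * y) = act γ g' x * act γ g' y := by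
  have : (mulL γ).compr₂ (act γ g') = (mulL γ).compl₁₂ (act γ g') (act γ g') :=
    lin_ext γ fun g₁ f₁ => lin_ext γ fun g₂ f₂ => by
      rw [LinearMap.compr₂_apply, LinearMap.compl₁₂_apply, act_a, act_a]
      by_cases h : g₁⁻¹ * g₂ ∈ H
      · obtain ⟨x, rfl⟩ := exists_coe h
        rw [← mul_assoc, mulL_a, mulL_a, mulBasis_coe, mulBasis_coe, map_smul, act_a]
      · rw [mulL_a_ne γ _ _ _ _ h, mulL_a_ne, map_zero]
        simpa [mul_assoc] using h
  exact LinearMap.congr_fun (LinearMap.congr_fun this x) y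

theorem act_act (g g' : G) (x : ZAlgebra γ) : act γ g (act γ g' x) = act γ (g * g') x := by
  have : (act γ g).comp (act γ g') = act γ (g * g') := lin_ext γ fun _ _ => by
    simp [act_a, mul_assoc]
  exact LinearMap.congr_fun this x

theorem act_one (x : ZAlgebra γ) : act γ 1 x = x := by
  have : act γ (1 : G) = LinearMap.id := lin_ext γ fun _ _ => by simp [act_a]
  exact LinearMap.congr_fun this x

/-- The action of `G` on `A(H, H, γ)` by algebra automorphisms, `g'(a_{g,f}) = a_{g'g,f}`. -/
def action : G →* (ZAlgebra γ ≃ₐ[k] ZAlgebra γ) where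
  toFun g := AlgEquiv.ofLinearEquiv
    (LinearEquiv.ofLinearMap (act γ g) (act γ g⁻¹)
      (by ext x; simp [act_act, act_one]) (by ext x; simp [act_act, act_one]))
    (by
      have h1 : ∀ y, act γ g 1 * y = y := fun y => by
        have : y = act γ g (act γ g⁻¹ y) := by simp [act_act, act_one]
        rw [this, ← act_mul, one_mul]
      exact (mul_one _).symm.trans (h1 1))
    (act_mul γ g)
  map_one' := by ext x; exact act_one γ x
  map_mul' g g' := by ext x; exact (act_act γ g g' x).symm

theorem action_a (g' g : G) (f : H) : action γ g' (a γ g f) = a γ (g' * g) f := act_a γ g' g f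

/-- The grading of `A(H, H, γ)` for which `a_{g,f}` has degree `g f g⁻¹`. -/
def grading (d : G) : Submodule k (ZAlgebra γ) :=
  Submodule.span k {x | ∃ (g : G) (f : H), g * f * g⁻¹ = d ∧ a γ g f = x}

theorem a_mem (g : G) (f : H) : a γ g f ∈ grading γ (g * f * g⁻¹) :=
  Submodule.subset_span ⟨g, f, rfl, rfl⟩

theorem a_mem' {g d : G} {f : H} (h : g * f * g⁻¹ = d) : a γ g f ∈ grading γ d :=
  Submodule.subset_span ⟨g, f, h, rfl⟩

theorem act_mem (g' d : G) {x : ZAlgebra γ} (hx : x ∈ grading γ d) :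
    action γ g' x ∈ grading γ (g' * d * g'⁻¹) := by
  induction hx using Submodule.span_induction with
  | mem x hx =>
    obtain ⟨g, f, rfl, rfl⟩ := hx
    rw [action_a]
    exact a_mem' γ (by group)
  | zero => simp
  | add x y _ _ hx hy => rw [map_add]; exact add_mem hx hy
  | smul r x _ hx => rw [map_smul]; exact Submodule.smul_mem _ _ hx

open scoped Classical in
/-- The decomposition of an element into homogeneous components. -/
def decomp : ZAlgebra γ →ₗ[k] DirectSum G fun d => grading γ d :=
  lift γ (fun g f => DirectSum.lof k G (fun d => grading γ d) (g * f * g⁻¹) ⟨a γ g f, a_mem γ g f⟩)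
    fun g h f => by
      rw [← map_smul]
      have hd : g * h * f * (g * h)⁻¹ = g * ↑(h * f * h⁻¹) * g⁻¹ := by push_cast; group
      refine DirectSum.of_eq_of_gradedMonoid_eq (A := fun d => grading γ d) ?_
      exact Sigma.subtype_ext hd (a_rel γ g h f)

open scoped Classical in
theorem isInternal : DirectSum.IsInternal (grading γ) := by
  have h1 : (DirectSum.coeLinearMap (grading γ)).comp (decomp γ) = LinearMap.id :=
    lin_ext γ fun g f => by
      rw [LinearMap.comp_apply, decomp, lift_a, DirectSum.coeLinearMap_lof]; rfl
  have h2 : ∀ d x (hx : x ∈ grading γ d), decomp γ x =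
      DirectSum.lof k G (fun d => grading γ d) d ⟨x, hx⟩ := by
    intro d x hx
    induction hx using Submodule.span_induction with
    | mem x hx =>
      obtain ⟨g, f, rfl, rfl⟩ := hx
      rw [decomp, lift_a]
    | zero => rw [map_zero]; exact (map_zero _).symm
    | add x y hx hy h1 h2 => rw [map_add, h1, h2, ← map_add]; rfl
    | smul r x hx h1 => rw [map_smul, h1, ← map_smul]; rfl
  have h3 : (decomp γ).comp (DirectSum.coeLinearMap (grading γ)) = LinearMap.id := by
    refine DirectSum.linearMap_ext k fun d => LinearMap.ext fun x => ?_
    rw [LinearMap.comp_apply, LinearMap.comp_apply, DirectSum.coeLinearMap_lof, h2 d x.1 x.2]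
    rfl
  exact ⟨Function.LeftInverse.injective (g := decomp γ) (LinearMap.congr_fun h3),
    Function.RightInverse.surjective (g := decomp γ) (LinearMap.congr_fun h1)⟩

theorem one_mem : (1 : ZAlgebra γ) ∈ grading γ 1 := by
  let _ := Fintype.ofFinite (G ⧸ H)
  refine Submodule.smul_mem _ ((γ 1 1)⁻¹ : kˣ).val (Submodule.sum_mem _ fun q _ => ?_)
  induction q using QuotientGroup.induction_on with
  | H g => exact a_mem' γ (by simp)

theorem mul_mem (d d' : G) (x y : ZAlgebra γ) (hx : x ∈ grading γ d) (hy : y ∈ grading γ d') :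
    x * y ∈ grading γ (d * d') := by
  induction hx using Submodule.span_induction with
  | mem x hx =>
    induction hy using Submodule.span_induction with
    | mem y hy =>
      obtain ⟨g, f, rfl, rfl⟩ := hx
      obtain ⟨g', f', rfl, rfl⟩ := hy
      change mulL γ _ _ ∈ _
      by_cases h : g⁻¹ * g' ∈ H
      · obtain ⟨h, rfl⟩ := exists_coe h
        rw [mulL_a, mulBasis_coe]
        refine Submodule.smul_mem _ _ (a_mem' γ ?_)
        push_cast; group
      · rw [mulL_a_ne γ _ _ _ _ h]; exact zero_mem _
    | zero => rw [mul_zero]; exact zero_mem _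
    | add y z _ _ h1 h2 => rw [mul_add]; exact add_mem h1 h2
    | smul r y _ h => rw [mul_smul_comm]; exact Submodule.smul_mem _ _ h
  | zero => rw [zero_mul]; exact zero_mem _
  | add y z _ _ h1 h2 => rw [add_mul]; exact add_mem h1 h2
  | smul r y _ h => rw [smul_mul_assoc]; exact Submodule.smul_mem _ _ h

/-- `A(H, H, γ)` is an algebra in `𝒵(G)`. -/
theorem isZAlgebra : IsZAlgebra (action γ) (grading γ) where
  grading :=
    { isInternal := isInternal γ
      compat := fun f g => by
        refine le_antisymm ?_ fun (x : ZAlgebra γ) hx => ?_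
        · rintro _ ⟨x, hx, rfl⟩
          exact act_mem γ f g hx
        · refine ⟨action γ f⁻¹ x, ?_, ?_⟩
          · have := act_mem γ f⁻¹ _ hx
            have e : f⁻¹ * (f * g * f⁻¹) * f⁻¹⁻¹ = g := by group
            rwa [e] at this
          · change action γ f (action γ f⁻¹ x) = x
            exact (act_act γ f f⁻¹ x).trans (by rw [mul_inv_cancel, act_one]) }
  one_mem := one_mem γ
  mul_mem := mul_mem γ

/-- `A(H, H, γ)` as an object (in fact an algebra, by `IsZAlgebra.monObj`) of the monoidal centre of
the category of representations of `G`. -/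
abbrev center : Center (Rep.{u} k G) := (isZAlgebra γ).center

end ZAlgebra

end AHH

end

/-!
Let `A = A(H, γ)` and `Z = A(H, H, γ)`.

An object of the monoidal centre of the category of representations of `G` is the same as a
representation `X` with a compatible `G`-grading. Indeed, a half braiding on `X` is determined by
naturality by its values `β(x ⊗ 1)` in `k[G] ⊗ X`, since every vector `u` of a representation `U` is
the image of `1` under a morphism `k[G] → U`. Compatibility with tensor products says that
`x ↦ β(x ⊗ 1)` is a coassociative coaction of `k[G]`, and invertibility makes it counital; such a
coaction is a grading (`CategoryTheory.HalfBraiding.isCompatibleGrading`,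
`IsCompatibleGrading.exists_centerObj_eq`). Morphisms of the centre are the equivariant maps that
preserve degrees.

For a graded `X`, a pair `(X, ξ)` is central if and only if `ξ` maps the component of degree `d`
into the subspace `A_d` of all `c ∈ A` with `c b = d(b) c` for all `b ∈ A`
(`IsCompatibleGrading.isCentralPair_iff`). The map `ζ : Z → A` sends `a_{g,f}` to the function
supported on `H g⁻¹` with value `ρ(e_f)` at `g⁻¹`. It is an equivariant homomorphism of algebras,
and restricts to a bijection from the component `Z_d` to `A_d` for each `d`:

* Testing `c ∈ A_d` against functions supported on the single coset `H g⁻¹` shows that `c(g⁻¹) = 0`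
  if `g⁻¹ d g ∉ H`, and that otherwise `ρ(e_f)⁻¹ c(g⁻¹)`, with `f = g⁻¹ d g`, is in the centre of
  `End(V)`, so that `c(g⁻¹)` is a multiple of `ρ(e_f)`. As `G ⧸ H` is finite, `c` is a finite sum of
  multiples of elements `ζ(a_{g,f})` (`ZAlgebra.exists_zeta_eq`).
* The component `Z_d` is spanned by one `a_{g,f}` for each coset `gH` with `f = g⁻¹ d g ∈ H`, and
  their images are non-zero functions with disjoint supports (`ZAlgebra.eq_zero_of_zeta_eq_zero`).

Hence a central pair `(X, ξ)` factors through `ζ`, on each component separately and uniquely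
(`ZAlgebra.existsUnique_hom`).
-/

noncomputable section

/-! ### Objects of the monoidal centre as graded representations -/

section CentreOfRep

variable {k G : Type u} [Field k] [Group G] {X : Rep.{u} k G}

namespace CategoryTheory.HalfBraiding

/-- The linear map `X ⊗ U → U ⊗ X` underlying a half braiding of a representation `X`. -/
def linearMap (b : HalfBraiding X) (U : Rep.{u} k G) : X.V ⊗[k] U.V →ₗ[k] U.V ⊗[k] X.V :=
  (b.β U).hom.hom.toLinearMap

variable (b : HalfBraiding X)

theorem linearMap_surjective (U : Rep.{u} k G) : Function.Surjective (b.linearMap U) := fun x =>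
  ⟨(b.β U).inv.hom x, Rep.hom_inv_apply _ _ (b.β U) x⟩

theorem linearMap_naturality {U U' : Rep.{u} k G} (f : U ⟶ U') (y : X.V) (u : U.V) :
    b.linearMap U' (y ⊗ₜ f.hom u) = f.hom.toLinearMap.rTensor X.V (b.linearMap U (y ⊗ₜ u)) :=
  congrArg (fun φ : X ⊗ U ⟶ U' ⊗ X => φ.hom (y ⊗ₜ u)) (b.naturality f)

theorem linearMap_equivariant (U : Rep.{u} k G) (g : G) (y : X.V) (u : U.V) :
    b.linearMap U (X.ρ g y ⊗ₜ U.ρ g u) =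
      TensorProduct.map (U.ρ g) (X.ρ g) (b.linearMap U (y ⊗ₜ u)) :=
  Rep.hom_comm_apply (b.β U).hom g (y ⊗ₜ u)

theorem linearMap_tensor (U U' : Rep.{u} k G) (y : X.V) (u : U.V) (u' : U'.V) :
    b.linearMap (U ⊗ U') (y ⊗ₜ (u ⊗ₜ u')) =
      (TensorProduct.assoc k U.V U'.V X.V).symm ((b.linearMap U').lTensor U.V
        (TensorProduct.assoc k U.V X.V U'.V (b.linearMap U (y ⊗ₜ u) ⊗ₜ u'))) :=
  congrArg (fun φ : X ⊗ (U ⊗ U') ⟶ (U ⊗ U') ⊗ X => φ.hom (y ⊗ₜ (u ⊗ₜ u'))) (b.monoidal U U')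

open scoped Classical in
/-- The isomorphism of `k[G] ⊗ X` with the finitely supported functions `G → X`. -/
def regularTensorEquiv (X : Rep.{u} k G) :
    (Rep.leftRegular k G).V ⊗[k] X.V ≃ₗ[k] (G →₀ X.V) :=
  (TensorProduct.congr (MonoidAlgebra.coeffLinearEquiv k) (LinearEquiv.refl k X.V)).trans
    (TensorProduct.finsuppScalarLeft k X.V G)

theorem regularTensorEquiv_single_tmul (g : G) (x : X.V) :
    regularTensorEquiv X (MonoidAlgebra.single g (1 : k) ⊗ₜ x) = Finsupp.single g x := by
  simp [regularTensorEquiv, TensorProduct.finsuppScalarLeft_apply_tmul]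

/-- The coaction `X → k[G] ⊗ X` of a half braiding, `x ↦ β(x ⊗ 1)`, where `k[G] ⊗ X` is regarded
as the space of finitely supported functions `G → X`. -/
def coaction : X.V →ₗ[k] (G →₀ X.V) :=
  (regularTensorEquiv X).toLinearMap.comp ((b.linearMap (Rep.leftRegular k G)).comp
    ((TensorProduct.mk k X.V (Rep.leftRegular k G).V).flip (MonoidAlgebra.single 1 1)))

/-- The map `(G →₀ X) → U ⊗ X` that sends the function with value `x` at `g` to `g(u) ⊗ x`. -/
def translateTensor (X : Rep.{u} k G) (U : Rep.{u} k G) (u : U.V) :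
    (G →₀ X.V) →ₗ[k] U.V ⊗[k] X.V :=
  Finsupp.lsum k fun g => TensorProduct.mk k U.V X.V (U.ρ g u)

theorem translateTensor_single (U : Rep.{u} k G) (u : U.V) (g : G) (x : X.V) :
    translateTensor X U u (Finsupp.single g x) = U.ρ g u ⊗ₜ x := by
  simp [translateTensor]

theorem regularTensorEquiv_symm_single (g : G) (x : X.V) :
    (regularTensorEquiv X).symm (Finsupp.single g x) = MonoidAlgebra.single g (1 : k) ⊗ₜ x := by
  rw [LinearEquiv.symm_apply_eq, regularTensorEquiv_single_tmul]

/-- By naturality, a half braiding is determined by its coaction, because every element of a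
representation `U` is the image of `1` under a morphism `k[G] → U`. -/
theorem linearMap_tmul (U : Rep.{u} k G) (y : X.V) (u : U.V) :
    b.linearMap U (y ⊗ₜ u) = translateTensor X U u (b.coaction y) := by
  have h1 : (Rep.leftRegularHom U u).hom (MonoidAlgebra.single 1 1) = u := by
    rw [Rep.leftRegularHom_hom_single]; simp
  have h2 : ((Rep.leftRegularHom U u).hom.toLinearMap.rTensor X.V).comp
      (regularTensorEquiv X).symm.toLinearMap = translateTensor X U u :=
    Finsupp.lhom_ext fun g x => by
      rw [LinearMap.comp_apply, LinearEquiv.coe_coe, regularTensorEquiv_symm_single,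
        LinearMap.rTensor_tmul, translateTensor_single]
      refine congrArg (· ⊗ₜ[k] x) ?_
      exact (Rep.leftRegularHom_hom_single g u 1).trans (one_smul k _)
  have h3 := b.linearMap_naturality (Rep.leftRegularHom U u) y (MonoidAlgebra.single 1 1)
  rw [h1] at h3
  rw [h3, ← h2, LinearMap.comp_apply]
  refine congrArg _ ?_
  exact ((regularTensorEquiv X).symm_apply_apply _).symm

/-- The coaction of a half braiding is coassociative. -/
theorem coaction_coaction (y : X.V) (g : G) :
    b.coaction (b.coaction y g) = Finsupp.single g (b.coaction y g) := by
  let R := Rep.leftRegular k G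
  let e : R.V := MonoidAlgebra.single 1 1
  -- the coefficient at `g` of the first factor of `k[G] ⊗ k[G] ⊗ X`
  let c : (R.V ⊗[k] R.V) ⊗[k] X.V →ₗ[k] (G →₀ X.V) :=
    (TensorProduct.lid k _).toLinearMap.comp ((TensorProduct.map
      ((Finsupp.lapply g).comp (MonoidAlgebra.coeffLinearEquiv k).toLinearMap)
      (regularTensorEquiv X).toLinearMap).comp (TensorProduct.assoc k R.V R.V X.V).toLinearMap)
  have h := congrArg c (b.linearMap_tensor R R y e e)
  rw [b.linearMap_tmul (R ⊗ R) y (e ⊗ₜ e), b.linearMap_tmul R y e] at h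
  have hl : c.comp (translateTensor X (R ⊗ R) (e ⊗ₜ e)) =
      (Finsupp.lsingle g).comp (Finsupp.lapply g) := by
    refine Finsupp.lhom_ext fun g' x => ?_
    rw [LinearMap.comp_apply, translateTensor_single]
    change ((MonoidAlgebra.coeffLinearEquiv k) (R.ρ g' e)) g •
      (regularTensorEquiv X (R.ρ g' e ⊗ₜ x)) = Finsupp.single g ((Finsupp.single g' x) g)
    have : R.ρ g' e = MonoidAlgebra.single g' 1 := by simp [R, e]
    rw [this, regularTensorEquiv_single_tmul]
    by_cases hg : g' = g
    · subst hg; simp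
    · simp [hg]
  have hr : c.comp (((TensorProduct.assoc k R.V R.V X.V).symm.toLinearMap.comp
      ((b.linearMap R).lTensor R.V)).comp ((TensorProduct.assoc k R.V X.V R.V).toLinearMap.comp
        (((TensorProduct.mk k _ R.V).flip e).comp (translateTensor X R e)))) =
      b.coaction.comp (Finsupp.lapply g) := by
    refine Finsupp.lhom_ext fun g' x => ?_
    have : R.ρ g' e = MonoidAlgebra.single g' 1 := by simp [R, e]
    simp only [LinearMap.comp_apply, translateTensor_single, this]
    change TensorProduct.lid k _ (TensorProduct.map
      ((Finsupp.lapply g).comp (MonoidAlgebra.coeffLinearEquiv k).toLinearMap)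
      (regularTensorEquiv X).toLinearMap (TensorProduct.assoc k R.V R.V X.V
        ((TensorProduct.assoc k R.V R.V X.V).symm (MonoidAlgebra.single g' (1 : k) ⊗ₜ
          b.linearMap R (x ⊗ₜ e))))) = _
    rw [LinearEquiv.apply_symm_apply]
    change ((MonoidAlgebra.coeffLinearEquiv k) (MonoidAlgebra.single g' (1 : k))) g •
      b.coaction x = b.coaction ((Finsupp.single g' x) g)
    by_cases hg : g' = g
    · subst hg; simp
    · simp [hg]
  have hl' := LinearMap.congr_fun hl (b.coaction y)
  have hr' := LinearMap.congr_fun hr (b.coaction y)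
  exact (hr'.symm.trans h.symm).trans hl'

/-- The coaction of a half braiding is counital: the map `x ↦ ∑ x_g` is idempotent by
coassociativity, and surjective because the half braiding with the unit object is invertible. -/
theorem sum_coaction (y : X.V) : ((b.coaction y).sum fun _ x => x) = y := by
  let s : X.V →ₗ[k] X.V := (Finsupp.lsum k fun _ => LinearMap.id).comp b.coaction
  have hs : ∀ y, s y = (b.coaction y).sum fun _ x => x := fun y => rfl
  have h1 : ∀ y, s (s y) = s y := fun y => by
    rw [hs y, Finsupp.sum, map_sum]
    refine Finset.sum_congr rfl fun g _ => ?_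
    rw [hs, b.coaction_coaction, Finsupp.sum_single_index rfl]
  have h2 : (b.linearMap (𝟙_ (Rep.{u} k G))).comp
      (TensorProduct.rid k X.V).symm.toLinearMap =
      (TensorProduct.lid k X.V).symm.toLinearMap.comp s := by
    ext y
    refine (b.linearMap_tmul (𝟙_ (Rep.{u} k G)) y (1 : k)).trans ?_
    change _ = (1 : k) ⊗ₜ[k] (s y)
    rw [hs, Finsupp.sum, TensorProduct.tmul_sum]
    rfl
  have h3 : Function.Surjective s := fun y => by
    obtain ⟨z, hz⟩ := b.linearMap_surjective (𝟙_ (Rep.{u} k G)) ((1 : k) ⊗ₜ y)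
    refine ⟨TensorProduct.rid k X.V z, ?_⟩
    have := LinearMap.congr_fun h2 (TensorProduct.rid k X.V z)
    simp only [LinearMap.comp_apply, LinearEquiv.coe_coe, LinearEquiv.symm_apply_apply] at this
    rw [hz] at this
    have h4 := congrArg (TensorProduct.lid k X.V) this
    simpa using h4.symm
  obtain ⟨z, rfl⟩ := h3 y
  exact h1 z

/-- The component of degree `g` for a half braiding: the elements `x` with `β(x ⊗ 1) = g ⊗ x`. -/
def component (g : G) : Submodule k X.V :=
  LinearMap.eqLocus b.coaction (Finsupp.lsingle g)

theorem mem_component {g : G} {x : X.V} :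
    x ∈ b.component g ↔ b.coaction x = Finsupp.single g x := Iff.rfl

theorem linearMap_of_mem {g : G} {x : X.V} (hx : x ∈ b.component g) (U : Rep.{u} k G) (u : U.V) :
    b.linearMap U (x ⊗ₜ u) = U.ρ g u ⊗ₜ x := by
  rw [b.linearMap_tmul, b.mem_component.1 hx, translateTensor_single]

theorem smul_mem_component (f g : G) {x : X.V} (hx : x ∈ b.component g) :
    X.ρ f x ∈ b.component (f * g * f⁻¹) := by
  let R := Rep.leftRegular k G
  have h := b.linearMap_equivariant R f x (MonoidAlgebra.single f⁻¹ 1)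
  rw [b.linearMap_of_mem hx, TensorProduct.map_tmul] at h
  have h1 : R.ρ f (MonoidAlgebra.single f⁻¹ 1) = MonoidAlgebra.single 1 1 := by simp [R]
  have h2 : R.ρ f (R.ρ g (MonoidAlgebra.single f⁻¹ 1)) =
    MonoidAlgebra.single (f * g * f⁻¹) 1 := by simp [R, mul_assoc]
  rw [h1, h2] at h
  exact (congrArg (regularTensorEquiv X) h).trans (regularTensorEquiv_single_tmul _ _)

open scoped Classical in
/-- The components are independent because the coaction separates them, and every `y` is the sum of
the values of its coaction, which are homogeneous by coassociativity. -/
theorem isInternal_component : DirectSum.IsInternal b.component := by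
  constructor
  · refine (injective_iff_map_eq_zero _).2 fun z hz => ?_
    have h : b.coaction.comp (DirectSum.coeLinearMap b.component) =
        DirectSum.toModule k G (G →₀ X.V) fun g =>
          (Finsupp.lsingle g).comp (b.component g).subtype :=
      DirectSum.linearMap_ext k fun g => LinearMap.ext fun x => by
        simpa [DirectSum.toModule_lof] using b.mem_component.1 x.2
    have h' : ∀ g, (Finsupp.lapply g).comp (DirectSum.toModule k G (G →₀ X.V) fun g =>
          (Finsupp.lsingle g).comp (b.component g).subtype) =
          (b.component g).subtype.comp (DirectSum.component k G (fun g => b.component g) g) := by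
      refine fun g => DirectSum.linearMap_ext k fun g' => LinearMap.ext fun x => ?_
      by_cases hg : g' = g
      · subst hg; simp [DirectSum.component.lof_self]
      · simp [DirectSum.component.of, hg]
    have h0 := LinearMap.congr_fun h z
    have hz' : DirectSum.coeLinearMap b.component z = 0 := hz
    rw [LinearMap.comp_apply, hz', map_zero] at h0
    refine DirectSum.ext_component k fun g => Subtype.ext ?_
    have := LinearMap.congr_fun (h' g) z
    rw [LinearMap.comp_apply, ← h0] at this
    simpa using this.symm
  · intro y
    refine ⟨∑ g ∈ (b.coaction y).support, DirectSum.of (fun g => b.component g) g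
      ⟨b.coaction y g, b.coaction_coaction y g⟩, ?_⟩
    rw [map_sum]
    simp only [DirectSum.coeAddMonoidHom_of]
    exact b.sum_coaction y

theorem isCompatibleGrading : IsCompatibleGrading X b.component where
  isInternal := b.isInternal_component
  compat f g := by
    refine le_antisymm ?_ fun x hx => ⟨X.ρ f⁻¹ x, ?_, by simp⟩
    · rintro _ ⟨x, hx, rfl⟩
      exact b.smul_mem_component f g hx
    · have := b.smul_mem_component f⁻¹ _ hx
      have e : f⁻¹ * (f * g * f⁻¹) * f⁻¹⁻¹ = g := by group
      rwa [e] at this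

theorem halfBraiding_isCompatibleGrading : b.isCompatibleGrading.halfBraiding = b := by
  have h : b.isCompatibleGrading.halfBraiding.β = b.β := by
    funext U
    refine Iso.ext ?_
    ext1; ext1
    refine b.isCompatibleGrading.tensor_ext fun g x hx u => ?_
    exact (b.isCompatibleGrading.braidFun_tmul U g hx u).trans (b.linearMap_of_mem hx U u).symm
  cases b
  simp only [IsCompatibleGrading.halfBraiding] at h ⊢
  congr

end CategoryTheory.HalfBraiding

/-- The objects of the monoidal centre of the category of representations of `G` are the
representations with a compatible grading. -/
theorem IsCompatibleGrading.exists_centerObj_eq (Y : Center (Rep.{u} k G)) :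
    ∃ (X : Rep.{u} k G) (gr : G → Submodule k X.V) (h : IsCompatibleGrading X gr),
      h.centerObj = Y :=
  ⟨Y.1, Y.2.component, Y.2.isCompatibleGrading,
    Sigma.ext rfl (heq_of_eq Y.2.halfBraiding_isCompatibleGrading)⟩

end CentreOfRep

/-! ### Morphisms and central pairs in terms of gradings -/

section CentreMorphisms

variable {k G : Type u} [Field k] [Group G]

namespace IsCompatibleGrading

variable {X : Rep.{u} k G} {gr : G → Submodule k X.V}

/-- The half braiding of a graded representation determines its grading. -/
theorem component_halfBraiding_le (h : IsCompatibleGrading X gr) (d : G) :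
    h.halfBraiding.component d ≤ gr d := by
  classical
  intro x hx
  let R := Rep.leftRegular k G
  -- the projection of `X` onto the component of degree `d`
  let π : X.V →ₗ[k] X.V := h.glue fun g => if g = d then LinearMap.id else 0
  have h1 : (gr d).mkQ.comp π = 0 := h.hom_ext fun g y hy => by
    rw [LinearMap.comp_apply, h.glue_apply _ g hy]
    split_ifs with hg
    · subst hg; simpa using hy
    · simp
  have h2 : (Finsupp.lapply d).comp h.halfBraiding.coaction = π := h.hom_ext fun g y hy => by
    have : h.halfBraiding.coaction y = Finsupp.single g y := by
      refine (congrArg (HalfBraiding.regularTensorEquiv X)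
        (h.braidFun_tmul R g hy (MonoidAlgebra.single 1 1))).trans ?_
      have h3 : R.ρ g (MonoidAlgebra.single 1 1) = MonoidAlgebra.single g 1 := by simp [R]
      rw [h3, HalfBraiding.regularTensorEquiv_single_tmul]
    rw [LinearMap.comp_apply, this, h.glue_apply _ g hy]
    by_cases hg : g = d
    · subst hg; simp
    · simp [hg]
  have h3 : π x = x := by
    rw [← h2, LinearMap.comp_apply, HalfBraiding.mem_component _ |>.1 hx]; simp
  have := LinearMap.congr_fun h1 x
  rw [LinearMap.comp_apply, h3] at this
  simpa using this

/-- Morphisms of the monoidal centre preserve degrees. -/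
theorem hom_mem {X' : Rep.{u} k G} {gr' : G → Submodule k X'.V} (h : IsCompatibleGrading X gr)
    (h' : IsCompatibleGrading X' gr') (φ : h.centerObj ⟶ h'.centerObj) {d : G} {x : X.V}
    (hx : x ∈ gr d) : φ.f.hom x ∈ gr' d := by
  refine h'.component_halfBraiding_le d ?_
  let R := Rep.leftRegular k G
  let e : R.V := MonoidAlgebra.single 1 1
  have h1 : h'.braidFun R (φ.f.hom x ⊗ₜ e) =
      φ.f.hom.toLinearMap.lTensor R.V (h.braidFun R (x ⊗ₜ e)) :=
    congrArg (fun ψ : X ⊗ R ⟶ R ⊗ X' => ψ.hom (x ⊗ₜ e)) (φ.comm R)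
  rw [h.braidFun_tmul R d hx] at h1
  have h2 : R.ρ d e = MonoidAlgebra.single d 1 := by simp [R, e]
  rw [h2] at h1
  exact (congrArg (HalfBraiding.regularTensorEquiv X') h1).trans
    (HalfBraiding.regularTensorEquiv_single_tmul _ _)

/-- An equivariant map that preserves degrees is a morphism of the monoidal centre. -/
def homOfMem {X' : Rep.{u} k G} {gr' : G → Submodule k X'.V} (h : IsCompatibleGrading X gr)
    (h' : IsCompatibleGrading X' gr') (φ : X ⟶ X') (hφ : ∀ d, ∀ x ∈ gr d, φ.hom x ∈ gr' d) :
    h.centerObj ⟶ h'.centerObj where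
  f := φ
  comm U := by
    ext1; ext1
    refine h.tensor_ext fun d x hx y => ?_
    change h'.braidFun U (φ.hom x ⊗ₜ y) = φ.hom.toLinearMap.lTensor U.V (h.braidFun U (x ⊗ₜ y))
    rw [h.braidFun_tmul U d hx, h'.braidFun_tmul U d (hφ d x hx)]
    rfl

/-- A morphism from a representation to a `G`-algebra `B`, as a linear map with values in `B`. -/
def toAlgebra {B : Type u} [Ring B] [Algebra k B] {α : G →* (B ≃ₐ[k] B)} (ξ : X ⟶ algRep α) :
    X.V →ₗ[k] B :=
  ξ.hom.toLinearMap

/-- A pair `(X, ξ)` with `X` graded is central if and only if `ξ(x) b = d(b) ξ(x)` for all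
`x ∈ X_d`. -/
theorem isCentralPair_iff (h : IsCompatibleGrading X gr) {B : Type u} [Ring B] [Algebra k B]
    (α : G →* (B ≃ₐ[k] B)) (ξ : X ⟶ algRep α) :
    IsCentralPair (algRep α) h.centerObj ξ ↔
      ∀ d, ∀ x ∈ gr d, ∀ b : B, toAlgebra ξ x * b = α d b * toAlgebra ξ x := by
  have key : ∀ d, ∀ x ∈ gr d, ∀ b : B,
      ((h.centerObj.2.β (algRep α)).hom ≫ (algRep α ◁ ξ) ≫ MonObj.mul).hom (x ⊗ₜ[k] b) =
        α d b * toAlgebra ξ x := fun d x hx b => by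
    change LinearMap.mul' k B (ξ.hom.toLinearMap.lTensor B (h.braidFun (algRep α) (x ⊗ₜ b))) = _
    refine (congrArg (fun w => LinearMap.mul' k B (ξ.hom.toLinearMap.lTensor B w))
      (h.braidFun_tmul (algRep α) d hx b)).trans ?_
    rfl
  constructor
  · intro hc d x hx b
    exact (congrArg (fun ψ : MonoidalCategory.tensorObj X (algRep α) ⟶ algRep α =>
      ψ.hom (x ⊗ₜ[k] b)) hc).trans (key d x hx b)
  · intro H
    refine Rep.hom_ext (Representation.IntertwiningMap.ext ?_)
    refine h.tensor_ext fun d x hx b => ?_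
    exact (H d x hx b).trans (key d x hx b).symm

end IsCompatibleGrading

end CentreMorphisms

/-! ### Induced algebras: functions supported on one coset -/

section InducedFunctions

variable {k G : Type u} [Field k] [Group G] {H : Subgroup G} {B : Type u} [Ring B] [Algebra k B]
  (β : H →* (B ≃ₐ[k] B))

open scoped Classical in
/-- The element of the induced algebra supported on `H g⁻¹` whose value at `g⁻¹` is `b`. -/
def indSingle (g : G) : B →ₗ[k] indAlgebra β where
  toFun b := ⟨fun x => if hx : x * g ∈ H then β ⟨x * g, hx⟩ b else 0, fun h x => by
    by_cases hx : x * g ∈ H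
    · have hx' : ↑h * x * g ∈ H := by
        rw [mul_assoc]; exact H.mul_mem h.2 hx
      have e : (⟨↑h * x * g, hx'⟩ : H) = h * ⟨x * g, hx⟩ := Subtype.ext (mul_assoc _ _ _)
      beta_reduce
      rw [dif_pos hx, dif_pos hx', e, map_mul]
      rfl
    · have hx' : ↑h * x * g ∉ H := by
        rwa [mul_assoc, Subgroup.mul_mem_cancel_left _ h.2]
      beta_reduce
      rw [dif_neg hx, dif_neg hx', map_zero]⟩
  map_add' b c := Subtype.ext <| funext fun x => by
    change (if hx : x * g ∈ H then β ⟨x * g, hx⟩ (b + c) else 0) =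
      (if hx : x * g ∈ H then β ⟨x * g, hx⟩ b else 0) +
        (if hx : x * g ∈ H then β ⟨x * g, hx⟩ c else 0)
    split_ifs <;> simp
  map_smul' r b := Subtype.ext <| funext fun x => by
    change (if hx : x * g ∈ H then β ⟨x * g, hx⟩ (r • b) else 0) =
      r • (if hx : x * g ∈ H then β ⟨x * g, hx⟩ b else 0)
    split_ifs <;> simp

theorem indSingle_apply {g x : G} {h : H} (hx : x * g = h) (b : B) :
    (indSingle β g b).1 x = β h b := by
  have h1 : x * g ∈ H := hx ▸ h.2
  have h2 : (⟨x * g, h1⟩ : H) = h := Subtype.ext hx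
  exact (dif_pos h1).trans (by rw [h2])

theorem indSingle_apply_inv (g : G) (b : B) : (indSingle β g b).1 g⁻¹ = b := by
  rw [indSingle_apply β (h := 1) (by simp), map_one]; rfl

theorem indSingle_apply_of_notMem {g x : G} (hx : x * g ∉ H) (b : B) :
    (indSingle β g b).1 x = 0 := dif_neg hx

theorem indSingle_mul_coe (g : G) (h : H) (b : B) :
    indSingle β (g * h) b = indSingle β g (β h b) := by
  refine Subtype.ext (funext fun x => ?_)
  by_cases hx : x * g ∈ H
  · rw [indSingle_apply β (h := ⟨x * g, hx⟩ * h) (by simp [mul_assoc]),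
      indSingle_apply β (h := ⟨x * g, hx⟩) rfl, map_mul]
    rfl
  · rw [indSingle_apply_of_notMem β hx, indSingle_apply_of_notMem]
    rwa [← mul_assoc, Subgroup.mul_mem_cancel_right _ h.2]

theorem indAction_indSingle (f g : G) (b : B) :
    indAction β f (indSingle β g b) = indSingle β (f * g) b := by
  refine Subtype.ext (funext fun x => ?_)
  rw [indAction_apply]
  by_cases hx : x * f * g ∈ H
  · rw [indSingle_apply β (h := ⟨_, hx⟩) rfl,
      indSingle_apply β (h := ⟨_, hx⟩) (mul_assoc x f g).symm]
  · rw [indSingle_apply_of_notMem β hx, indSingle_apply_of_notMem]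
    rwa [← mul_assoc]

theorem indSingle_mul_same (g : G) (b c : B) :
    indSingle β g b * indSingle β g c = indSingle β g (b * c) := by
  refine Subtype.ext (funext fun x => ?_)
  change (indSingle β g b).1 x * (indSingle β g c).1 x = _
  by_cases hx : x * g ∈ H
  · simp only [indSingle_apply β (h := ⟨_, hx⟩) rfl, map_mul]
  · simp only [indSingle_apply_of_notMem β hx, mul_zero]

theorem indSingle_mul_of_notMem {g g' : G} (hg : g⁻¹ * g' ∉ H) (b c : B) :
    indSingle β g b * indSingle β g' c = 0 := by
  refine Subtype.ext (funext fun x => ?_)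
  change (indSingle β g b).1 x * (indSingle β g' c).1 x = 0
  by_cases hx : x * g ∈ H
  · have hx' : x * g' ∉ H := fun hx' => hg (by
      have := H.mul_mem (H.inv_mem hx) hx'
      simpa [mul_assoc] using this)
    rw [indSingle_apply_of_notMem β hx', mul_zero]
  · rw [indSingle_apply_of_notMem β hx, zero_mul]

theorem indSingle_out_apply_of_ne {q q' : G ⧸ H} (hq : q ≠ q') (b : B) :
    (indSingle β q.out b).1 q'.out⁻¹ = 0 :=
  indSingle_apply_of_notMem β (fun h => hq (by
    rw [← q.out_eq', ← q'.out_eq']; exact (QuotientGroup.eq.2 h).symm)) b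

/-- Two elements of the induced algebra agree if they agree on representatives of the cosets. -/
theorem indAlgebra_ext {a b : indAlgebra β} (h : ∀ q : G ⧸ H, a.1 q.out⁻¹ = b.1 q.out⁻¹) :
    a = b := by
  refine Subtype.ext (funext fun x => ?_)
  obtain ⟨y, hy⟩ := QuotientGroup.mk_out_eq_mul H x⁻¹
  have hx : x = y * (Quotient.out ((x⁻¹ : G) : G ⧸ H))⁻¹ := by rw [hy]; group
  rw [hx, a.2, b.2, h]

theorem sum_indSingle [Fintype (G ⧸ H)] (a : indAlgebra β) :
    ∑ q : G ⧸ H, indSingle β q.out (a.1 q.out⁻¹) = a := by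
  refine indAlgebra_ext β fun q => ?_
  rw [AddSubmonoidClass.coe_finsetSum, Finset.sum_apply, Finset.sum_eq_single q
    (fun q' _ hq' => indSingle_out_apply_of_ne β hq' _) (by simp), indSingle_apply_inv]

end InducedFunctions

/-! ### The universal morphism from `A(H, H, γ)` to `A(H, γ)` -/

section Zeta

variable {k G : Type u} [Field k] [Group G] {H : Subgroup G} {γ : TwoCocycle k H}
  {V : Type u} [AddCommGroup V] [Module k V] (ρ : SkewGroupAlgebra γ →ₐ[k] Module.End k V)

theorem endAction_apply (h : H) (x : Module.End k V) :
    endAction ρ h x = projUnit ρ h * x * ↑(projUnit ρ h)⁻¹ := rfl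

theorem endAction_mul_projUnit (h : H) (x : Module.End k V) :
    endAction ρ h x * projUnit ρ h = projUnit ρ h * x := by
  rw [endAction_apply, Units.inv_mul_cancel_right]

theorem endAction_projUnit (h f : H) :
    endAction ρ h (projUnit ρ f) =
      (γ.eps h f : k) • (projUnit ρ (h * f * h⁻¹) : Module.End k V) := by
  rw [endAction_apply, Units.mul_inv_eq_iff_eq_mul, smul_mul_assoc]
  change ρ (SkewGroupAlgebra.e γ h) * ρ (SkewGroupAlgebra.e γ f) = (γ.eps h f : k) •
    (ρ (SkewGroupAlgebra.e γ (h * f * h⁻¹)) * ρ (SkewGroupAlgebra.e γ h))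
  rw [← map_mul, ← map_mul, ← map_smul, γ.e_conj]

theorem projUnit_one :
    (projUnit ρ 1 : Module.End k V) = (γ 1 1 : k) • (1 : Module.End k V) := by
  change ρ (SkewGroupAlgebra.e γ 1) = _
  rw [SkewGroupAlgebra.e_one, map_smul, map_one]

/-- If `c b = d(b) c` for all `b` in the induced algebra and `g⁻¹ d g ∉ H`, then `c` vanishes at
`g⁻¹`. -/
theorem apply_inv_eq_zero_of_forall_mul_eq {d g : G} {c : indAlgebra (endAction ρ)}
    (hc : ∀ b, c * b = indAction (endAction ρ) d b * c) (hg : g⁻¹ * d * g ∉ H) :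
    c.1 g⁻¹ = 0 := by
  have h := congrArg (fun a : indAlgebra (endAction ρ) => a.1 g⁻¹)
    (hc (indSingle (endAction ρ) g 1))
  change c.1 g⁻¹ * (indSingle _ g 1).1 g⁻¹ = (indSingle _ g 1).1 (g⁻¹ * d) * c.1 g⁻¹ at h
  rwa [indSingle_apply_inv, mul_one, indSingle_apply_of_notMem _ hg, zero_mul] at h

/-- If `c b = d(b) c` for all `b` in the induced algebra and `d = g f g⁻¹` with `f ∈ H`, then
`ρ(e_f)⁻¹ c(g⁻¹)` commutes with all of `End(V)`, so that `c(g⁻¹)` is a multiple of `ρ(e_f)`. -/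
theorem exists_apply_inv_eq_smul_of_forall_mul_eq {g : G} {f : H} {c : indAlgebra (endAction ρ)}
    (hc : ∀ b, c * b = indAction (endAction ρ) (g * f * g⁻¹) b * c) :
    ∃ r : k, c.1 g⁻¹ = r • (projUnit ρ f : Module.End k V) := by
  have h1 : ∀ x : Module.End k V, c.1 g⁻¹ * x = endAction ρ f x * c.1 g⁻¹ := fun x => by
    have h := congrArg (fun a : indAlgebra (endAction ρ) => a.1 g⁻¹)
      (hc (indSingle (endAction ρ) g x))
    change c.1 g⁻¹ * (indSingle _ g x).1 g⁻¹ =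
      (indSingle _ g x).1 (g⁻¹ * (g * f * g⁻¹)) * c.1 g⁻¹ at h
    rwa [indSingle_apply_inv, indSingle_apply _ (h := f) (by simp [mul_assoc])] at h
  have h2 : ↑(projUnit ρ f)⁻¹ * c.1 g⁻¹ ∈ Subalgebra.center k (Module.End k V) := by
    refine Subalgebra.mem_center_iff.2 fun x => ?_
    rw [mul_assoc, h1, endAction_apply, mul_assoc (projUnit ρ f : Module.End k V),
      mul_assoc (projUnit ρ f : Module.End k V), Units.inv_mul_cancel_left, mul_assoc]
  rw [Algebra.IsCentral.center_eq_bot] at h2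
  obtain ⟨r, hr⟩ := Algebra.mem_bot.1 h2
  refine ⟨r, ?_⟩
  rw [Units.eq_inv_mul_iff_mul_eq, Algebra.algebraMap_eq_smul_one, mul_smul_comm, mul_one] at hr
  exact hr.symm

namespace ZAlgebra

/-- The map `ζ : A(H, H, γ) → A(H, γ)`; it sends `a_{g,f}` to the function supported on `H g⁻¹`
with value `ρ(e_f)` at `g⁻¹`. -/
def zeta : ZAlgebra γ →ₗ[k] indAlgebra (endAction ρ) :=
  lift γ (fun g f => indSingle (endAction ρ) g (projUnit ρ f)) fun g h f => by
    rw [indSingle_mul_coe, endAction_projUnit, map_smul]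

theorem zeta_a (g : G) (f : H) :
    zeta ρ (a γ g f) = indSingle (endAction ρ) g (projUnit ρ f) := lift_a γ _ _ _ _

variable [H.FiniteIndex]

theorem zeta_act (g : G) (x : ZAlgebra γ) :
    zeta ρ (act γ g x) = indAction (endAction ρ) g (zeta ρ x) := by
  have : (zeta ρ).comp (act γ g) =
      (indAction (endAction ρ) g).toLinearMap.comp (zeta ρ) := lin_ext γ fun g' f => by
    rw [LinearMap.comp_apply, LinearMap.comp_apply, act_a, zeta_a, zeta_a]
    exact (indAction_indSingle (endAction ρ) g g' _).symm
  exact LinearMap.congr_fun this x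

theorem zeta_mulL (x y : ZAlgebra γ) : zeta ρ (mulL γ x y) = zeta ρ x * zeta ρ y := by
  have : (mulL γ).compr₂ (zeta ρ) =
      (LinearMap.mul k (indAlgebra (endAction ρ))).compl₁₂ (zeta ρ) (zeta ρ) :=
    lin_ext γ fun g f => lin_ext γ fun g' f' => by
      rw [LinearMap.compr₂_apply, LinearMap.compl₁₂_apply, LinearMap.mul_apply']
      by_cases hg : g⁻¹ * g' ∈ H
      · obtain ⟨h, rfl⟩ := exists_coe hg
        rw [a_rel, map_smul, mulL_a_same, map_smul, map_smul, map_smul, mul_smul_comm, zeta_a,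
          zeta_a, zeta_a, indSingle_mul_same, projUnit_mul, map_smul]
      · rw [mulL_a_ne γ _ _ _ _ hg, map_zero, zeta_a, zeta_a, indSingle_mul_of_notMem _ hg]
  exact LinearMap.congr_fun (LinearMap.congr_fun this x) y

/-- The elements of degree `d` are mapped to elements `c` with `c b = d(b) c` for all `b`. -/
theorem zeta_mul_of_mem {d : G} {z : ZAlgebra γ} (hz : z ∈ grading γ d)
    (b : indAlgebra (endAction ρ)) :
    zeta ρ z * b = indAction (endAction ρ) d b * zeta ρ z := by
  induction hz using Submodule.span_induction with
  | mem z hz =>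
    obtain ⟨g, f, rfl, rfl⟩ := hz
    rw [zeta_a]
    refine Subtype.ext (funext fun x => ?_)
    change (indSingle _ g _).1 x * b.1 x = b.1 (x * (g * f * g⁻¹)) * (indSingle _ g _).1 x
    by_cases hx : x * g ∈ H
    · have h1 : x = ((⟨x * g, hx⟩ : H) : G) * g⁻¹ := by simp
      have h2 : x * (g * f * g⁻¹) = ((⟨x * g, hx⟩ : H) : G) * (f * g⁻¹) := by simp [mul_assoc]
      rw [h2, b.2, b.2, indSingle_apply _ (h := ⟨x * g, hx⟩) rfl, ← map_mul,
        endAction_mul_projUnit, map_mul]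
      exact congrArg _ ((congrArg b.1 h1).trans (b.2 _ _))
    · rw [indSingle_apply_of_notMem _ hx, zero_mul, mul_zero]
  | zero => rw [map_zero, zero_mul, mul_zero]
  | add y z _ _ hy hz => rw [map_add, add_mul, mul_add, hy, hz]
  | smul r z _ hz => rw [map_smul, smul_mul_assoc, mul_smul_comm, hz]

/-- Every `c` with `c b = d(b) c` for all `b` in the induced algebra is the image of an element of
degree `d`. -/
theorem exists_zeta_eq {d : G} {c : indAlgebra (endAction ρ)}
    (hc : ∀ b, c * b = indAction (endAction ρ) d b * c) :
    ∃ z ∈ grading γ d, zeta ρ z = c := by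
  let _ := Fintype.ofFinite (G ⧸ H)
  change c ∈ (grading γ d).map (zeta ρ)
  rw [← sum_indSingle (endAction ρ) c]
  refine Submodule.sum_mem _ fun q _ => ?_
  by_cases hq : q.out⁻¹ * d * q.out ∈ H
  · have hd : q.out * ((⟨_, hq⟩ : H) : G) * q.out⁻¹ = d := by simp [mul_assoc]
    obtain ⟨r, hr⟩ := exists_apply_inv_eq_smul_of_forall_mul_eq ρ (g := q.out) (f := ⟨_, hq⟩)
      (c := c) (by rwa [hd])
    rw [hr, map_smul, ← zeta_a]
    exact Submodule.smul_mem _ _ (Submodule.mem_map_of_mem (a_mem' γ hd))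
  · rw [apply_inv_eq_zero_of_forall_mul_eq ρ hc hq, map_zero]
    exact zero_mem _

open scoped Classical in
variable (γ) in
/-- The spanning elements of the component of degree `d`, one for each coset `gH`: the element
`a_{g,f}` with `f = g⁻¹ d g` if this is in `H`, for the chosen representative `g`, and otherwise
zero. -/
def homogeneous (d : G) (q : G ⧸ H) : ZAlgebra γ :=
  if hq : q.out⁻¹ * d * q.out ∈ H then a γ q.out ⟨_, hq⟩ else 0

variable (γ) in
theorem grading_le_span_homogeneous (d : G) :
    grading γ d ≤ Submodule.span k (Set.range (homogeneous γ d)) := by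
  refine Submodule.span_le.2 ?_
  rintro _ ⟨g, f, rfl, rfl⟩
  obtain ⟨h, hh⟩ := QuotientGroup.mk_out_eq_mul H g
  have hg : g = Quotient.out (g : G ⧸ H) * ((h⁻¹ : H) : G) := by rw [hh]; simp
  have hq : (Quotient.out (g : G ⧸ H))⁻¹ * (g * f * g⁻¹) * Quotient.out (g : G ⧸ H) =
      ((h⁻¹ * f * h⁻¹⁻¹ : H) : G) := by
    rw [hh]; push_cast; group
  have h1 : homogeneous γ (g * f * g⁻¹) (g : G ⧸ H) =
      a γ (Quotient.out (g : G ⧸ H)) (h⁻¹ * f * h⁻¹⁻¹) := by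
    have hm := hq ▸ (h⁻¹ * f * h⁻¹⁻¹ : H).2
    have e : (⟨_, hm⟩ : H) = h⁻¹ * f * h⁻¹⁻¹ := Subtype.ext hq
    exact (dif_pos hm).trans (by rw [e])
  have h2 : a γ g f = (γ.eps h⁻¹ f : k) • homogeneous γ (g * f * g⁻¹) (g : G ⧸ H) := by
    rw [h1, ← a_rel, ← hg]
  rw [h2]
  exact Submodule.smul_mem _ _ (Submodule.subset_span ⟨_, rfl⟩)

/-- `ζ` is injective on every component of the grading (but not on `A(H, H, γ)` in general). -/
theorem eq_zero_of_zeta_eq_zero [Nontrivial V] {d : G} {z : ZAlgebra γ} (hz : z ∈ grading γ d)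
    (h0 : zeta ρ z = 0) : z = 0 := by
  let _ := Fintype.ofFinite (G ⧸ H)
  obtain ⟨c, rfl⟩ := (Submodule.mem_span_range_iff_exists_fun k).1
    (grading_le_span_homogeneous γ d hz)
  refine Finset.sum_eq_zero fun q _ => ?_
  by_cases hq : q.out⁻¹ * d * q.out ∈ H
  · have h1 := congrArg (fun b : indAlgebra (endAction ρ) => b.1 q.out⁻¹) h0
    change (zeta ρ (∑ q, c q • homogeneous γ d q)).1 q.out⁻¹ = 0 at h1
    rw [map_sum, AddSubmonoidClass.coe_finsetSum, Finset.sum_apply, Finset.sum_eq_single q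
      (fun q' _ hq' => ?_) (by simp)] at h1
    · rw [map_smul, homogeneous, dif_pos hq, zeta_a] at h1
      change c q • (indSingle (endAction ρ) _ _).1 q.out⁻¹ = 0 at h1
      rw [indSingle_apply_inv, smul_eq_zero] at h1
      rw [h1.resolve_right (Units.ne_zero _), zero_smul]
    · rw [map_smul]
      change c q' • (zeta ρ (homogeneous γ d q')).1 q.out⁻¹ = 0
      rw [homogeneous]
      split_ifs
      · rw [zeta_a, indSingle_out_apply_of_ne _ hq', smul_zero]
      · rw [map_zero]; exact smul_zero _
  · rw [homogeneous, dif_neg hq, smul_zero]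

theorem eq_of_zeta_eq [Nontrivial V] {d : G} {z z' : ZAlgebra γ} (hz : z ∈ grading γ d)
    (hz' : z' ∈ grading γ d) (h : zeta ρ z = zeta ρ z') : z = z' :=
  sub_eq_zero.1 (eq_zero_of_zeta_eq_zero ρ (sub_mem hz hz') (by rw [map_sub, h, sub_self]))

theorem zeta_one : zeta ρ 1 = 1 := by
  let _ := Fintype.ofFinite (G ⧸ H)
  have h : ∀ q : G ⧸ H, zeta ρ (aCoset γ q) =
      (γ 1 1 : k) • indSingle (endAction ρ) q.out ((1 : indAlgebra (endAction ρ)).1 q.out⁻¹) := by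
    intro q
    have : aCoset γ q = a γ q.out 1 := by
      conv_lhs => rw [← q.out_eq']
      rfl
    rw [this, zeta_a, projUnit_one, map_smul]
    rfl
  change zeta ρ (one γ) = 1
  rw [one, Units.smul_def, map_smul, map_sum, Finset.sum_congr rfl fun q _ => h q,
    ← Finset.smul_sum, sum_indSingle, smul_smul, Units.inv_mul, one_smul]

/-- `ζ` as a morphism of representations of `G`. -/
def zetaHom : (center γ).1 ⟶ inducedEndAlgebra ρ :=
  Rep.ofHom (ρ := algRepresentation (action γ))
    (σ := algRepresentation (indAction (endAction ρ)))
    ⟨zeta ρ, fun g => LinearMap.ext fun x => zeta_act ρ g x⟩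

theorem isAlgHomFromCenter_zetaHom :
    IsAlgHomFromCenter (inducedEndAlgebra ρ) (center γ) (zetaHom ρ) where
  one_hom := by
    refine Rep.hom_ext (Representation.IntertwiningMap.ext (LinearMap.ext_ring ?_))
    change zeta ρ (algebraMap k (ZAlgebra γ) 1) = algebraMap k (indAlgebra (endAction ρ)) 1
    rw [map_one (algebraMap k (ZAlgebra γ)), zeta_one, map_one]
  mul_hom := by
    refine Rep.hom_ext (Representation.IntertwiningMap.ext (TensorProduct.ext' fun x y => ?_))
    exact zeta_mulL ρ x y

/-- A pair `(Y, ξ)` with `Y` graded factors uniquely through `ζ`: on the component of degree `d`,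
the map `ξ` has values in the elements `c` with `c b = d(b) c`, on which `ζ` can be inverted. -/
theorem existsUnique_hom [Nontrivial V] {X : Rep.{u} k G} {gr : G → Submodule k X.V}
    (h : IsCompatibleGrading X gr) (ξ : X ⟶ inducedEndAlgebra ρ)
    (hξ : IsCentralPair (inducedEndAlgebra ρ) h.centerObj ξ) :
    ∃! φ : h.centerObj ⟶ center γ, φ.f ≫ zetaHom ρ = ξ := by
  have hξ' := (h.isCentralPair_iff _ ξ).1 hξ
  have hinj : ∀ d, LinearMap.ker ((zeta ρ).comp (grading γ d).subtype) = ⊥ := fun d =>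
    LinearMap.ker_eq_bot'.2 fun z hz => Subtype.ext (eq_zero_of_zeta_eq_zero ρ z.2 hz)
  -- a linear map on all of `A(H, γ)` that inverts `ζ` on the image of the component of degree `d`
  choose r hr using fun d => LinearMap.exists_leftInverse_of_injective _ (hinj d)
  let ψ : X.V →ₗ[k] ZAlgebra γ :=
    h.glue fun d => (grading γ d).subtype.comp ((r d).comp ξ.hom.toLinearMap)
  have hψ : ∀ d, ∀ x ∈ gr d, ψ x ∈ grading γ d ∧ zeta ρ (ψ x) = ξ.hom x := fun d x hx => by
    obtain ⟨z, hz, hzx⟩ := exists_zeta_eq ρ (hξ' d x hx)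
    have h1 : ψ x = z := by
      refine (h.glue_apply _ d hx).trans
        (congrArg Subtype.val ?_ : _ = ((⟨z, hz⟩ : grading γ d) : ZAlgebra γ))
      refine Eq.trans ?_ (LinearMap.congr_fun (hr d) ⟨z, hz⟩)
      exact congrArg (r d) hzx.symm
    rw [h1]
    exact ⟨hz, hzx⟩
  have hG : ∀ g, ψ.comp (X.ρ g) = (act γ g).comp ψ := fun g => h.hom_ext fun d x hx => by
    have h1 := hψ d x hx
    have h2 := hψ _ _ (h.mem g d hx)
    refine eq_of_zeta_eq ρ h2.1 (act_mem γ g d h1.1) ?_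
    refine h2.2.trans ((Rep.hom_comm_apply ξ g x).trans ?_)
    refine Eq.trans ?_ (zeta_act ρ g (ψ x)).symm
    exact congrArg (indAction (endAction ρ) g) h1.2.symm
  let φ : X ⟶ (center γ).1 := Rep.ofHom (ρ := X.ρ) (σ := algRepresentation (action γ)) ⟨ψ, hG⟩
  refine ⟨h.homOfMem (isZAlgebra γ).grading φ fun d x hx => (hψ d x hx).1, ?_, fun φ' hφ' => ?_⟩
  · refine Rep.hom_ext (Representation.IntertwiningMap.ext (h.hom_ext fun d x hx => ?_))
    exact (hψ d x hx).2
  · refine Center.ext _ _ (Rep.hom_ext (Representation.IntertwiningMap.ext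
      (h.hom_ext fun d x hx => ?_)))
    refine eq_of_zeta_eq ρ (h.hom_mem (isZAlgebra γ).grading φ' hx) (hψ d x hx).1 ?_
    exact (congrArg (fun χ : X ⟶ inducedEndAlgebra ρ => χ.hom x) hφ').trans (hψ d x hx).2.symm

theorem isFullCentre_zetaHom [Nontrivial V] :
    IsFullCentre (inducedEndAlgebra ρ) (center γ) (zetaHom ρ) where
  central := ((isZAlgebra γ).grading.isCentralPair_iff _ (zetaHom ρ)).2
    fun _ _ hz b => zeta_mul_of_mem ρ hz b
  terminal Y ξ hξ := by
    obtain ⟨X, gr, h, rfl⟩ := IsCompatibleGrading.exists_centerObj_eq Y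
    exact existsUnique_hom ρ h ξ hξ

end ZAlgebra

end Zeta

end

theorem mainTheorem9 {k G : Type u} [Field k] [Group G] (H : Subgroup G) [H.FiniteIndex]
    (γ : TwoCocycle k H) (V : Type u) [AddCommGroup V] [Module k V]
    (ρ : SkewGroupAlgebra γ →ₐ[k] Module.End k V) (hρ : IsIrreducibleProjective ρ) :
    IsFullCentreAlgebra (inducedEndAlgebra ρ) (ZAlgebra.center γ) := by
  have := hρ.1
  exact ⟨ZAlgebra.zetaHom ρ, ZAlgebra.isFullCentre_zetaHom ρ,
    ZAlgebra.isAlgHomFromCenter_zetaHom ρ⟩
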